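/- Let $k$ be a field and let $(\mathcal B,\mathbb E,\mathfrak s)$ be a $k$-linear, Hom-finite, Krull–Schmidt extriangulated category (in the sense of Nakaoka–Palu) with enough projectives and enough injectives; let $\mathcal P$ be the full subcategory of projective objects. Let $\mathcal B/\mathcal P$ be the quotient of $\mathcal B$ by the ideal of morphisms factoring through an object of $\mathcal P$, and write $\underline f$ for the image of a morphism $f$ in $\mathcal B/\mathcal P$. Let $\mathcal T$ be a full subcategory of $\mathcal B$, closed under isomorphisms, finite direct sums and direct summands, which is contravariantly finite in $\mathcal B$ and satisfies $\mathcal P\subseteq\mathcal T$ and $\mathbb E(T,P)=0$ for all $T\in\mathcal T$, $P\in\mathcal P$. Let $\Omega\mathcal T$ be the full subcategory of objects $R$ admitting an $\mathbb E$-triangle $R\to P\to T\dashrightarrow$ with $P\in\mathcal P$, $T\in\mathcal T$, and let $\underline{\Omega\mathcal T}$ be the full subcategory of $\mathcal B/\mathcal P$ on the objects of $\Omega\mathcal T$. Let $\operatorname{mod}\underline{\Omega\mathcal T}$ be the category of finitely presented functors $\underline{\Omega\mathcal T}^{\mathrm{op}}\to\mathsf{Ab}$, i.e. cokernels of morphisms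 between representable functors. Put $H=\operatorname{Hom}_{\mathcal B/\mathcal P}(\Omega\mathcal T,-)$, which sends $X$ to the functor $R\mapsto\operatorname{Hom}_{\mathcal B/\mathcal P}(R,X)$ on $\underline{\Omega\mathcal T}$. For an object $A$, consider commutative diagrams $$\begin{array}{ccccc} R_1 & = & R_1 & & \\ {\scriptstyle f}\downarrow & & \downarrow & & \\ R_2 & \to & P & \to & T_2\dashrightarrow\\ {\scriptstyle g}\downarrow & & \downarrow & & \|\\ A & \xrightarrow{\,h\,} & T_1 & \to & T_2\dashrightarrow \end{array}\qquad(\ast)$$ with $T_1,T_2\in\mathcal T$ and $P\in\mathcal P$, in which the two lower rows $R_2\to P\to T_2\dashrightarrow$ and $A\to T_1\to T_2\dashrightarrow$ and the two left columns $R_1\to R_2\to A\dashrightarrow$ and $R_1\to P\to T_1\dashrightarrow$ are $\mathbb E$-triangles, and the maps between the two rows and between the two columns are morphisms of $\mathbb E$-triangles. Then $H$ takes values in $\operatorname{mod}\underline{\Omega\mathcal T}$, and the functor $H\colon\mathcal B/\mathcal P\to\operatorname{mod}\underline{\Omega\mathcal T}$ is full and dense if and only if both of the following conditions hold. (a) In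 every diagram $(\ast)$, for every object $A$, in which $\underline f\neq 0$ and $\underline f$ is right minimal in $\mathcal B/\mathcal P$ (every endomorphism $\rho$ of $R_1$ in $\mathcal B/\mathcal P$ with $\underline f\rho=\underline f$ is an isomorphism), one has $H(\underline h)=0$. (b) Every indecomposable object $A$ of $\mathcal B$ with $H(A)\neq 0$ admits a diagram $(\ast)$ with $H(\underline h)=0$. -/

import Mathlib

open CategoryTheory CategoryTheory.Limits Opposite
open scoped ZeroObject

universe w v u

noncomputable section

namespace Extri

/-! ### Extensions for a bifunctor `E : Bᵒᵖ × B → Ab` -/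

section Ext

variable {B : Type u} [Category.{v} B] (E : Bᵒᵖ ⥤ B ⥤ AddCommGrpCat.{w})

/-- The group `E(C, A)` of `E`-extensions. -/
abbrev Ext (C A : B) : Type w := (E.obj (op C)).obj A

variable {E}

/-- `a_* δ = E(C, a)(δ)`. -/
def push {C A A' : B} (a : A ⟶ A') (δ : Ext E C A) : Ext E C A' :=
  ((E.obj (op C)).map a).hom δ

/-- `c^* δ = E(c, A)(δ)`. -/
def pull {C C' A : B} (c : C' ⟶ C) (δ : Ext E C A) : Ext E C' A :=
  ((E.map c.op).app A).hom δ

/-- `δ ⊕ δ'`: the element of `E(C ⊕ C', A ⊕ A')` whose components are `(δ, 0, 0, δ')`. -/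
def extSum [Preadditive B] [HasBinaryBiproducts B] {C A C' A' : B}
    (δ : Ext E C A) (δ' : Ext E C' A') : Ext E (C ⊞ C') (A ⊞ A') :=
  push biprod.inl (pull biprod.fst δ) + push biprod.inr (pull biprod.snd δ')

end Ext

/-! ### Extriangulated categories -/

/-- An extriangulated structure `(E, 𝔰)` on an additive category `B`. The realization `𝔰` is given
by the relation "the sequence `A ⟶ X ⟶ C` realizes `δ`"; the first three axioms on it say that the
sequences realizing a given `δ` form exactly one equivalence class. -/
structure ExtriangulatedStructure (B : Type u) [Category.{v} B] [Preadditive B]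
    [HasZeroObject B] [HasBinaryBiproducts B] where
  /-- the bifunctor `E` -/
  E : Bᵒᵖ ⥤ B ⥤ AddCommGrpCat.{w}
  /-- (ET1): `E` is additive in the second variable -/
  additive_right : ∀ C : Bᵒᵖ, (E.obj C).Additive
  /-- (ET1): `E` is additive in the first variable -/
  additive_left : ∀ A : B, (E.flip.obj A).Additive
  /-- `Tri x y δ`: the sequence `A ⟶ X ⟶ C` realizes `δ`, that is, `(x, y, δ)` is an
  `E`-triangle. -/
  Tri : ∀ {A X C : B}, (A ⟶ X) → (X ⟶ C) → Ext E C A → Prop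
  exists_tri : ∀ {A C : B} (δ : Ext E C A), ∃ (X : B) (x : A ⟶ X) (y : X ⟶ C), Tri x y δ
  tri_of_equiv : ∀ {A X X' C : B} {x : A ⟶ X} {y : X ⟶ C} {δ : Ext E C A} (b : X ≅ X')
    {x' : A ⟶ X'} {y' : X' ⟶ C}, Tri x y δ → x ≫ b.hom = x' → b.hom ≫ y' = y → Tri x' y' δ
  equiv_of_tri : ∀ {A X X' C : B} {x : A ⟶ X} {y : X ⟶ C} {x' : A ⟶ X'} {y' : X' ⟶ C}
    {δ : Ext E C A}, Tri x y δ → Tri x' y' δ →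
    ∃ b : X ≅ X', x ≫ b.hom = x' ∧ b.hom ≫ y' = y
  /-- (ET2): every morphism of extensions is realized -/
  realize : ∀ {A X C A' X' C' : B} {x : A ⟶ X} {y : X ⟶ C} {δ : Ext E C A}
    {x' : A' ⟶ X'} {y' : X' ⟶ C'} {δ' : Ext E C' A'}, Tri x y δ → Tri x' y' δ' →
    ∀ (a : A ⟶ A') (c : C ⟶ C'), push a δ = pull c δ' →
    ∃ b : X ⟶ X', x ≫ b = a ≫ x' ∧ y ≫ c = b ≫ y'
  /-- (ET2): the realization is additive -/
  tri_zero : ∀ A C : B, Tri (biprod.inl : A ⟶ A ⊞ C) (biprod.snd : A ⊞ C ⟶ C) (0 : Ext E C A)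
  tri_sum : ∀ {A X C A' X' C' : B} {x : A ⟶ X} {y : X ⟶ C} {δ : Ext E C A}
    {x' : A' ⟶ X'} {y' : X' ⟶ C'} {δ' : Ext E C' A'}, Tri x y δ → Tri x' y' δ' →
    Tri (biprod.map x x') (biprod.map y y') (extSum δ δ')
  /-- (ET3) -/
  et3 : ∀ {A X C A' X' C' : B} {x : A ⟶ X} {y : X ⟶ C} {δ : Ext E C A}
    {x' : A' ⟶ X'} {y' : X' ⟶ C'} {δ' : Ext E C' A'}, Tri x y δ → Tri x' y' δ' →
    ∀ (a : A ⟶ A') (b : X ⟶ X'), x ≫ b = a ≫ x' →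
    ∃ c : C ⟶ C', y ≫ c = b ≫ y' ∧ push a δ = pull c δ'
  /-- (ET3)ᵒᵖ -/
  et3_op : ∀ {A X C A' X' C' : B} {x : A ⟶ X} {y : X ⟶ C} {δ : Ext E C A}
    {x' : A' ⟶ X'} {y' : X' ⟶ C'} {δ' : Ext E C' A'}, Tri x y δ → Tri x' y' δ' →
    ∀ (b : X ⟶ X') (c : C ⟶ C'), y ≫ c = b ≫ y' →
    ∃ a : A ⟶ A', x ≫ b = a ≫ x' ∧ push a δ = pull c δ'
  /-- (ET4) -/
  et4 : ∀ {A X C D F : B} {f : A ⟶ X} {f' : X ⟶ D} {δ : Ext E D A}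
    {g : X ⟶ C} {g' : C ⟶ F} {δ' : Ext E F X}, Tri f f' δ → Tri g g' δ' →
    ∃ (G : B) (h' : C ⟶ G) (d : D ⟶ G) (e : G ⟶ F) (δ'' : Ext E G A),
      f' ≫ d = g ≫ h' ∧ h' ≫ e = g' ∧ Tri (f ≫ g) h' δ'' ∧ Tri d e (push f' δ') ∧
      pull d δ'' = δ ∧ push f δ'' = pull e δ'
  /-- (ET4)ᵒᵖ -/
  et4_op : ∀ {A X C D F : B} {f' : D ⟶ A} {f : A ⟶ X} {δ : Ext E X D}
    {g' : F ⟶ X} {g : X ⟶ C} {δ' : Ext E C F}, Tri f' f δ → Tri g' g δ' →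
    ∃ (G : B) (h' : G ⟶ A) (d : D ⟶ G) (e : G ⟶ F) (δ'' : Ext E C G),
      d ≫ h' = f' ∧ h' ≫ f = e ≫ g' ∧ Tri h' (f ≫ g) δ'' ∧ Tri d e (pull g' δ) ∧
      push e δ'' = δ' ∧ push d δ = pull g δ''

section Defs

variable {B : Type u} [Category.{v} B] [Preadditive B] [HasZeroObject B] [HasBinaryBiproducts B]

namespace ExtriangulatedStructure

variable (𝔼 : ExtriangulatedStructure.{w} B)

/-- The subcategory `𝓟` of projective objects. -/
def proj : ObjectProperty B := fun P =>
  ∀ ⦃A X C : B⦄ (x : A ⟶ X) (y : X ⟶ C) (δ : Ext 𝔼.E C A), 𝔼.Tri x y δ →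
    ∀ c : P ⟶ C, ∃ b : P ⟶ X, b ≫ y = c

/-- The subcategory `𝓘` of injective objects. -/
def inj : ObjectProperty B := fun I =>
  ∀ ⦃A X C : B⦄ (x : A ⟶ X) (y : X ⟶ C) (δ : Ext 𝔼.E C A), 𝔼.Tri x y δ →
    ∀ a : A ⟶ I, ∃ b : X ⟶ I, x ≫ b = a

def EnoughProjectives : Prop :=
  ∀ C : B, ∃ (A P : B) (x : A ⟶ P) (y : P ⟶ C) (δ : Ext 𝔼.E C A), 𝔼.proj P ∧ 𝔼.Tri x y δ

def EnoughInjectives : Prop :=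
  ∀ A : B, ∃ (I C : B) (x : A ⟶ I) (y : I ⟶ C) (δ : Ext 𝔼.E C A), 𝔼.inj I ∧ 𝔼.Tri x y δ

/-- `Ω 𝓣 = CoCone(𝓟, 𝓣)`: the objects `R` admitting an `E`-triangle `R ⟶ P ⟶ T ⇢` with
`P ∈ 𝓟` and `T ∈ 𝓣`. -/
def syzygy (𝓣 : ObjectProperty B) : ObjectProperty B := fun R =>
  ∃ (P T : B) (x : R ⟶ P) (y : P ⟶ T) (δ : Ext 𝔼.E T R), 𝔼.proj P ∧ 𝓣 T ∧ 𝔼.Tri x y δ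

/-! #### The stable category `B/𝓟` -/

/-- `f` factors through a projective object. -/
def FactorsProj {X Y : B} (f : X ⟶ Y) : Prop :=
  ∃ (P : B) (a : X ⟶ P) (b : P ⟶ Y), 𝔼.proj P ∧ a ≫ b = f

/-- `f ~ g` if `f - g` factors through a projective object. -/
def stableRel : HomRel B := fun _ _ f g => 𝔼.FactorsProj (f - g)

variable {𝔼}

lemma proj_zero : 𝔼.proj (0 : B) := fun _ _ _ _ _ _ _ _ => ⟨0, (isZero_zero B).eq_of_src _ _⟩

lemma proj_biprod {P Q : B} (hP : 𝔼.proj P) (hQ : 𝔼.proj Q) : 𝔼.proj (P ⊞ Q) := by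
  intro A X C x y δ h c
  obtain ⟨b, hb⟩ := hP x y δ h (biprod.inl ≫ c)
  obtain ⟨b', hb'⟩ := hQ x y δ h (biprod.inr ≫ c)
  exact ⟨biprod.desc b b', by ext <;> simp [hb, hb']⟩

lemma FactorsProj.zero (X Y : B) : 𝔼.FactorsProj (0 : X ⟶ Y) :=
  ⟨0, 0, 0, proj_zero, by simp⟩

lemma FactorsProj.neg {X Y : B} {f : X ⟶ Y} (hf : 𝔼.FactorsProj f) : 𝔼.FactorsProj (-f) := by
  obtain ⟨P, a, b, hP, rfl⟩ := hf
  exact ⟨P, a, -b, hP, by simp⟩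

lemma FactorsProj.add {X Y : B} {f g : X ⟶ Y} (hf : 𝔼.FactorsProj f) (hg : 𝔼.FactorsProj g) :
    𝔼.FactorsProj (f + g) := by
  obtain ⟨P, a, b, hP, rfl⟩ := hf
  obtain ⟨Q, c, d, hQ, rfl⟩ := hg
  exact ⟨P ⊞ Q, biprod.lift a c, biprod.desc b d, proj_biprod hP hQ, by simp⟩

lemma FactorsProj.comp_left {X Y Z : B} (f : X ⟶ Y) {g : Y ⟶ Z} (hg : 𝔼.FactorsProj g) :
    𝔼.FactorsProj (f ≫ g) := by
  obtain ⟨P, a, b, hP, rfl⟩ := hg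
  exact ⟨P, f ≫ a, b, hP, by simp⟩

lemma FactorsProj.comp_right {X Y Z : B} {f : X ⟶ Y} (g : Y ⟶ Z) (hf : 𝔼.FactorsProj f) :
    𝔼.FactorsProj (f ≫ g) := by
  obtain ⟨P, a, b, hP, rfl⟩ := hf
  exact ⟨P, a, b ≫ g, hP, by simp⟩

variable (𝔼)

instance congruence_stableRel : Congruence 𝔼.stableRel where
  comp_left f g g' h := by
    change 𝔼.FactorsProj _
    rw [← Preadditive.comp_sub]
    exact FactorsProj.comp_left f h
  comp_right g h := by
    change 𝔼.FactorsProj _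
    rw [← Preadditive.sub_comp]
    exact FactorsProj.comp_right g h
  equivalence :=
    { refl := fun f => by
        change 𝔼.FactorsProj _
        rw [sub_self]
        exact FactorsProj.zero _ _
      symm := fun {f g} h => by
        change 𝔼.FactorsProj _
        rw [← neg_sub]
        exact FactorsProj.neg h
      trans := fun {f g k} h h' => by
        change 𝔼.FactorsProj _
        rw [← sub_add_sub_cancel f g k]
        exact FactorsProj.add h h' }

/-- The quotient category `B/𝓟`. -/
abbrev Stable : Type u := Quotient 𝔼.stableRel

instance preadditiveStable : Preadditive 𝔼.Stable :=
  Quotient.preadditive 𝔼.stableRel (fun _ _ f₁ f₂ g₁ g₂ h h' => by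
    change 𝔼.FactorsProj _
    rw [add_sub_add_comm]
    exact FactorsProj.add h h')

/-- The quotient functor `B ⥤ B/𝓟`, `f ↦ f̲`. -/
abbrev toStable : B ⥤ 𝔼.Stable := Quotient.functor 𝔼.stableRel

/-- The objects of `Ω 𝓣`, viewed in `B/𝓟`. -/
def stableSyzygy (𝓣 : ObjectProperty B) : ObjectProperty 𝔼.Stable := fun X => 𝔼.syzygy 𝓣 X.as

/-- `Ω 𝓣 / 𝓟`, the full subcategory of `B/𝓟` on the objects of `Ω 𝓣`. -/
abbrev SyzygyCat (𝓣 : ObjectProperty B) : Type u := (𝔼.stableSyzygy 𝓣).FullSubcategory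

/-- The functor `Hom_{B/𝓟}(Ω 𝓣, -)`, sending `X` to the presheaf of abelian groups
`R ↦ Hom_{B/𝓟}(R, X)` on `Ω 𝓣 / 𝓟`. -/
def H (𝓣 : ObjectProperty B) : 𝔼.Stable ⥤ ((𝔼.SyzygyCat 𝓣)ᵒᵖ ⥤ AddCommGrpCat.{v}) :=
  preadditiveYoneda ⋙ (Functor.whiskeringLeft _ _ _).obj (𝔼.stableSyzygy 𝓣).ι.op

/-- A commutative diagram
```
R₁ === R₁
|f     |i
R₂ -r→ P -q→ T₂ ⇢
|g     |p    ‖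
A  -h→ T₁ -t→ T₂ ⇢
⇣      ⇣
```
whose rows and columns are `E`-triangles, with `T₁, T₂ ∈ 𝓣` and `P ∈ 𝓟`. The maps between the two
rows and between the two columns are morphisms of `E`-triangles. -/
structure Diagram (𝓣 : ObjectProperty B) (A : B) where
  {R₁ R₂ P T₁ T₂ : B}
  f : R₁ ⟶ R₂
  g : R₂ ⟶ A
  i : R₁ ⟶ P
  p : P ⟶ T₁
  r : R₂ ⟶ P
  q : P ⟶ T₂
  h : A ⟶ T₁
  t : T₁ ⟶ T₂
  colLeft : Ext 𝔼.E A R₁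
  colRight : Ext 𝔼.E T₁ R₁
  rowTop : Ext 𝔼.E T₂ R₂
  rowBot : Ext 𝔼.E T₂ A
  tri_colLeft : 𝔼.Tri f g colLeft
  tri_colRight : 𝔼.Tri i p colRight
  tri_rowTop : 𝔼.Tri r q rowTop
  tri_rowBot : 𝔼.Tri h t rowBot
  comm_upper : f ≫ r = i
  comm_left : g ≫ h = r ≫ p
  comm_right : p ≫ t = q
  push_rowTop : push g rowTop = rowBot
  pull_colRight : pull h colRight = colLeft
  mem_T₁ : 𝓣 T₁
  mem_T₂ : 𝓣 T₂
  proj_P : 𝔼.proj P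

end ExtriangulatedStructure

/-- Every object is a finite direct sum of objects with local endomorphism rings. -/
def KrullSchmidt (B : Type u) [Category.{v} B] [Preadditive B] : Prop :=
  ∀ X : B, ∃ (n : ℕ) (Y : Fin n → B) (b : Bicone Y),
    (∀ i, IsLocalRing (End (Y i))) ∧ Nonempty b.IsBilimit ∧ Nonempty (X ≅ b.pt)

/-- `𝓣` is contravariantly finite: every object has a right `𝓣`-approximation. -/
def ContravariantlyFinite (𝓣 : ObjectProperty B) : Prop :=
  ∀ X : B, ∃ (T₀ : B) (f : T₀ ⟶ X), 𝓣 T₀ ∧ ∀ (T : B) (g : T ⟶ X), 𝓣 T → ∃ s : T ⟶ T₀, s ≫ f = g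

end Defs

/-- A morphism `f : X ⟶ Y` is right minimal if every endomorphism `r` of `X` with `f ∘ r = f` is an
isomorphism. -/
def RightMinimal {C : Type u} [Category.{v} C] {X Y : C} (f : X ⟶ Y) : Prop :=
  ∀ r : X ⟶ X, r ≫ f = f → IsIso r

/-- `F` lies in `mod C`: it is the cokernel of a morphism of representable functors. -/
def FinitelyPresented {C : Type u} [Category.{v} C] [Preadditive C]
    (F : Cᵒᵖ ⥤ AddCommGrpCat.{v}) : Prop :=
  ∃ (R₁ R₀ : C) (f : R₁ ⟶ R₀), Nonempty (F ≅ cokernel (preadditiveYoneda.map f))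

end Extri

end

/-! A diagram (∗) gives a sequence R₁ → R₂ → A → T₁ in B/𝓟 with R₁, R₂ in Ω𝓣. `E`-triangles are
stably exact in the middle (`Tri.exists_stable_lift`), and H(h) = 0 says exactly that H(g) is epi
(`Diagram.H_map_h_eq_zero_iff`); in that case H(A) is the cokernel of H(f). Since E(𝓣, 𝓟) = 0, every
map out of R₁ that factors through a projective extends along R₁ → P, so g is a weak cokernel of f
in B/𝓟 (`Diagram.exists_stable_desc`).

From (a) and (b) to full and dense: the weak cokernel property and Yoneda lift every map out of H(A)
when H(h) = 0 (`Diagram.exists_H_map_eq`), and Krull–Schmidt reduces fullness to indecomposables.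
For density, a stable morphism of Ω𝓣 becomes the right minimal f of a diagram once a summand of its
source on which it vanishes is discarded (`exists_rightMinimal_diagram`); unless it is zero, (a)
identifies its cokernel with H(A).

Conversely, let f be right minimal and let u : R₂ → X present the cokernel of H(f) as H(X). The weak
cokernel property gives c : A → X, fullness gives s : X → A, and the composite A → X → A fixes g.
Right minimality makes that composite invertible (`Diagram.isIso_stable_of_rightMinimal`), so H(g)
is epi like H(u), which is (a). For (b), a presentation of H(A) built from approximations is made
minimal; its diagram ends in A' ≅ A ⊞ Q with Q projective, and Q is split off. -/

noncomputable section

namespace Extri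

/-! ### Functoriality of extensions. -/

section ExtLemmas

variable {B : Type u} [Category.{v} B] {E : Bᵒᵖ ⥤ B ⥤ AddCommGrpCat.{w}}

@[simp] lemma push_id {C A : B} (δ : Ext E C A) : push (𝟙 A) δ = δ := by simp [push]

@[simp] lemma pull_id {C A : B} (δ : Ext E C A) : pull (𝟙 C) δ = δ := by simp [pull]

lemma push_comp {C A A' A'' : B} (a : A ⟶ A') (a' : A' ⟶ A'') (δ : Ext E C A) :
    push (a ≫ a') δ = push a' (push a δ) := by simp [push]

lemma pull_comp {C C' C'' A : B} (c : C ⟶ C') (c' : C' ⟶ C'') (δ : Ext E C'' A) :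
    pull (c ≫ c') δ = pull c (pull c' δ) := by simp [pull]

lemma push_pull {C C' A A' : B} (a : A ⟶ A') (c : C' ⟶ C) (δ : Ext E C A) :
    push a (pull c δ) = pull c (push a δ) :=
  (ConcreteCategory.congr_hom ((E.map c.op).naturality a) δ).symm

@[simp] lemma push_zero {C A A' : B} (a : A ⟶ A') : push a (0 : Ext E C A) = 0 := map_zero _

@[simp] lemma pull_zero {C C' A : B} (c : C' ⟶ C) : pull c (0 : Ext E C A) = 0 := map_zero _

end ExtLemmas

/-! ### Exactness properties and constructions of `E`-triangles. -/

namespace ExtriangulatedStructure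

variable {B : Type u} [Category.{v} B] [Preadditive B] [HasZeroObject B] [HasBinaryBiproducts B]
  {𝔼 : ExtriangulatedStructure.{w} B}

lemma sub_push {C A A' : B} (a b : A ⟶ A') (δ : Ext 𝔼.E C A) :
    push (a - b) δ = push a δ - push b δ := by
  have := 𝔼.additive_right (op C)
  simp [push, Functor.map_sub]

lemma sub_pull {C C' A : B} (a b : C' ⟶ C) (δ : Ext 𝔼.E C A) :
    pull (a - b) δ = pull a δ - pull b δ := by
  have := 𝔼.additive_left A
  have h : (𝔼.E.flip.obj A).map (a.op - b.op) = _ := Functor.map_sub _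
  exact ConcreteCategory.congr_hom h δ

@[simp] lemma push_zero_hom {C A A' : B} (δ : Ext 𝔼.E C A) : push (0 : A ⟶ A') δ = 0 := by
  simpa using sub_push (0 : A ⟶ A') 0 δ

@[simp] lemma pull_zero_hom {C C' A : B} (δ : Ext 𝔼.E C A) : pull (0 : C' ⟶ C) δ = 0 := by
  simpa using sub_pull (0 : C' ⟶ C) 0 δ

variable {A X C : B} {x : A ⟶ X} {y : X ⟶ C} {δ : Ext 𝔼.E C A}

/-- This and the next exactness statements come from comparing the triangle with a split one that
has a zero object at one end. -/
lemma Tri.comp_eq_zero (h : 𝔼.Tri x y δ) : x ≫ y = 0 := by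
  obtain ⟨c, hc, -⟩ := 𝔼.et3 (𝔼.tri_zero A 0) h (𝟙 A) (biprod.fst ≫ x) (by simp)
  have hc0 : c = 0 := (isZero_zero B).eq_of_src _ _
  have : biprod.inl ≫ ((biprod.fst : A ⊞ (0 : B) ⟶ A) ≫ x) ≫ y = 0 := by rw [← hc, hc0]; simp
  simpa using this

lemma Tri.exists_lift (h : 𝔼.Tri x y δ) {W : B} (z : W ⟶ X) (hz : z ≫ y = 0) :
    ∃ a : W ⟶ A, a ≫ x = z := by
  obtain ⟨a, ha, -⟩ := 𝔼.et3_op (𝔼.tri_zero W 0) h (biprod.fst ≫ z) 0 (by simp [hz])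
  exact ⟨a, by simpa using ha.symm⟩

lemma Tri.exists_desc (h : 𝔼.Tri x y δ) {W : B} (z : X ⟶ W) (hz : x ≫ z = 0) :
    ∃ c : C ⟶ W, y ≫ c = z := by
  obtain ⟨c, hc, -⟩ := 𝔼.et3 h (𝔼.tri_zero 0 W) 0 (z ≫ biprod.inr) (by simp [reassoc_of% hz])
  exact ⟨c, by simpa using hc⟩

lemma Tri.exists_extend (h : 𝔼.Tri x y δ) {A' : B} (a : A ⟶ A') (ha : push a δ = 0) :
    ∃ b : X ⟶ A', x ≫ b = a := by
  obtain ⟨b, hb, -⟩ := 𝔼.realize h (𝔼.tri_zero A' 0) a 0 (by simp [ha])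
  exact ⟨b ≫ biprod.fst, by simp [reassoc_of% hb]⟩

lemma Tri.push_eq_zero (h : 𝔼.Tri x y δ) : push x δ = 0 := by
  obtain ⟨c, -, hc⟩ := 𝔼.et3 h (𝔼.tri_zero X 0) x biprod.inl rfl
  simp [hc]

lemma Tri.push_comp_eq_zero (h : 𝔼.Tri x y δ) {A' : B} (b : X ⟶ A') : push (x ≫ b) δ = 0 := by
  rw [push_comp, h.push_eq_zero, push_zero]

lemma Tri.exists_coextend (h : 𝔼.Tri x y δ) {C' : B} (c : C' ⟶ C) (hc : pull c δ = 0) :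
    ∃ b : C' ⟶ X, b ≫ y = c := by
  obtain ⟨b, -, hb⟩ := 𝔼.realize (𝔼.tri_zero 0 C') h 0 c (by simp [hc])
  exact ⟨biprod.inr ≫ b, by simp [← hb]⟩

lemma Tri.pull_eq_zero (h : 𝔼.Tri x y δ) : pull y δ = 0 := by
  obtain ⟨a, -, ha⟩ := 𝔼.et3_op (𝔼.tri_zero 0 X) h biprod.snd y rfl
  simp [← ha]

/-- A morphism whose difference to the identity squares to zero is an isomorphism. -/
lemma isIso_of_sq_zero {D : Type*} [Category D] [Preadditive D] {X : D} (b : X ⟶ X)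
    (h : (b - 𝟙 X) ≫ (b - 𝟙 X) = 0) : IsIso b := by
  have h' : b ≫ b = b + b - 𝟙 X := by
    simp only [Preadditive.comp_sub, Preadditive.sub_comp, Category.comp_id,
      Category.id_comp] at h
    rw [← sub_eq_zero, ← h]; abel
  exact ⟨𝟙 X + 𝟙 X - b, by simp [h'], by simp [h']⟩

lemma isIso_of_isIso_comp {D : Type*} [Category D] {X Y : D} (c : X ⟶ Y) (d : Y ⟶ X)
    (_ : IsIso (c ≫ d)) (_ : IsIso (d ≫ c)) : IsIso c := by
  have : IsSplitMono c := ⟨⟨d ≫ inv (c ≫ d), by rw [← Category.assoc, IsIso.hom_inv_id]⟩⟩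
  have : IsSplitEpi c := ⟨⟨inv (d ≫ c) ≫ d, by simp⟩⟩
  exact isIso_of_mono_of_isSplitEpi c

/-- An endomorphism of an `E`-triangle that is the identity at both ends is an isomorphism. -/
lemma Tri.isIso_middle (h : 𝔼.Tri x y δ) (b : X ⟶ X) (hx : x ≫ b = x) (hy : b ≫ y = y) :
    IsIso b := by
  obtain ⟨n, hn⟩ := h.exists_desc (b - 𝟙 X) (by simp [hx])
  refine isIso_of_sq_zero b ?_
  nth_rewrite 2 [← hn]
  rw [← Category.assoc, Preadditive.sub_comp, hy]
  simp

/-- The difference c - 1 kills δ, hence factors through y, while y kills c - 1; so its square is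
zero. -/
lemma Tri.isIso_right (h : 𝔼.Tri x y δ) (c : C ⟶ C) (hy : y ≫ c = y) (hc : pull c δ = δ) :
    IsIso c := by
  obtain ⟨z, hz⟩ := h.exists_coextend (c - 𝟙 C) (by rw [sub_pull, hc]; simp)
  refine isIso_of_sq_zero c ?_
  nth_rewrite 1 [← hz]
  rw [Category.assoc, Preadditive.comp_sub, hy]
  simp

/-- The cone of an inflation is unique up to isomorphism. -/
lemma Tri.nonempty_iso_cone (h : 𝔼.Tri x y δ) {C' : B} {y' : X ⟶ C'} {δ' : Ext 𝔼.E C' A}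
    (h' : 𝔼.Tri x y' δ') : Nonempty (C ≅ C') := by
  obtain ⟨c, hc, hc'⟩ := 𝔼.et3 h h' (𝟙 A) (𝟙 X) (by simp)
  obtain ⟨d, hd, hd'⟩ := 𝔼.et3 h' h (𝟙 A) (𝟙 X) (by simp)
  simp only [push_id, Category.id_comp] at hc hc' hd hd'
  have h₁ : IsIso (c ≫ d) := h.isIso_right _ (by rw [reassoc_of% hc, hd])
    (by rw [pull_comp, ← hd', ← hc'])
  have h₂ : IsIso (d ≫ c) := h'.isIso_right _ (by rw [reassoc_of% hd, hc])
    (by rw [pull_comp, ← hc', ← hd'])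
  have : IsIso c := isIso_of_isIso_comp c d h₁ h₂
  exact ⟨asIso c⟩

/-- An `E`-triangle with vanishing extension splits. -/
lemma Tri.nonempty_iso_biprod (h : 𝔼.Tri x y δ) (hδ : δ = 0) : Nonempty (X ≅ A ⊞ C) := by
  subst hδ
  obtain ⟨b, -⟩ := 𝔼.equiv_of_tri h (𝔼.tri_zero A C)
  exact ⟨b⟩

lemma Tri.sum_trivial (h : 𝔼.Tri x y δ) (Y : B) :
    ∃ (y' : Y ⊞ X ⟶ (0 : B) ⊞ C) (δ' : Ext 𝔼.E ((0 : B) ⊞ C) (Y ⊞ A)),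
      𝔼.Tri (biprod.map (𝟙 Y) x) y' δ' := by
  refine ⟨biprod.map 0 y, _, 𝔼.tri_of_equiv
    (biprod.mapIso (⟨biprod.fst, biprod.inl, ?_, by simp⟩ : Y ⊞ (0 : B) ≅ Y) (Iso.refl X))
    (𝔼.tri_sum (𝔼.tri_zero Y (0 : B)) h) ?_ ?_⟩
  · ext
    · simp
  · ext <;> simp
  · ext <;> simp

lemma Tri.sum_trivial_right (h : 𝔼.Tri x y δ) (Y : B) :
    ∃ (y' : X ⊞ Y ⟶ C ⊞ (0 : B)) (δ' : Ext 𝔼.E (C ⊞ (0 : B)) (A ⊞ Y)),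
      𝔼.Tri (biprod.map x (𝟙 Y)) y' δ' := by
  refine ⟨biprod.map y 0, _, 𝔼.tri_of_equiv
    (biprod.mapIso (Iso.refl X) (⟨biprod.fst, biprod.inl, ?_, by simp⟩ : Y ⊞ (0 : B) ≅ Y))
    (𝔼.tri_sum h (𝔼.tri_zero Y (0 : B))) ?_ ?_⟩
  · ext
    · simp
  · ext <;> simp
  · ext <;> simp

/-- The graph of a morphism `m : X ⟶ Y` is a split inflation. -/
lemma tri_graph {X Y : B} (m : X ⟶ Y) :
    𝔼.Tri (biprod.lift m (𝟙 X)) (biprod.fst - biprod.snd ≫ m) (0 : Ext 𝔼.E Y X) := by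
  refine 𝔼.tri_of_equiv ⟨biprod.lift (biprod.snd + biprod.fst ≫ m) biprod.fst,
    biprod.lift biprod.snd (biprod.fst - biprod.snd ≫ m), ?_, ?_⟩ (𝔼.tri_zero X Y) ?_ ?_
  · ext <;> simp
  · ext <;> simp
  · ext <;> simp
  · ext <;> simp

/-- If `x : A ⟶ X` is an inflation, then so is `(f, x) : A ⟶ Y ⊞ X`. -/
lemma Tri.exists_tri_lift (h : 𝔼.Tri x y δ) {Y : B} (f : A ⟶ Y) :
    ∃ (D : B) (g : Y ⊞ X ⟶ D) (ε : Ext 𝔼.E D A), 𝔼.Tri (biprod.lift f x) g ε := by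
  obtain ⟨y', δ', h'⟩ := h.sum_trivial Y
  -- (f, x) is the graph of f followed by 𝟙 ⊞ x, a composite of two inflations.
  obtain ⟨G, g, -, -, ε, -, -, hT, -⟩ := 𝔼.et4 (tri_graph f) h'
  refine ⟨G, g, ε, ?_⟩
  convert hT using 1
  ext <;> simp

end ExtriangulatedStructure

/-! ### Split idempotents, Fitting's lemma and indecomposable objects. -/

section KrullSchmidt

variable {B : Type u} [Category.{v} B] [Preadditive B]

/-- `φ` is a split idempotent. -/
def IsSplitIdem {X : B} (φ : X ⟶ X) : Prop :=
  ∃ (W : B) (i : W ⟶ X) (p : X ⟶ W), i ≫ p = 𝟙 W ∧ p ≫ i = φ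

lemma isIso_or_isIso_one_sub_of_isLocalRing {Y : B} (h : IsLocalRing (End Y)) (a : Y ⟶ Y) :
    IsIso a ∨ IsIso (𝟙 Y - a) := by
  have := IsLocalRing.isUnit_or_isUnit_of_add_one (R := End Y) (a := End.of a)
    (b := End.of (𝟙 Y - a)) (add_sub_cancel a (𝟙 Y))
  exact this.imp (isUnit_iff_isIso _).1 (isUnit_iff_isIso _).1

/-- An idempotent that is a sum of morphisms through objects with local endomorphism rings
splits. -/
lemma isSplitIdem_of_eq_sum [HasZeroObject B] [HasBinaryBiproducts B] {X : B} (n : ℕ) :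
    ∀ (Y : Fin n → B) (_ : ∀ i, IsLocalRing (End (Y i))) (p : ∀ i, X ⟶ Y i) (q : ∀ i, Y i ⟶ X)
      (φ : X ⟶ X), φ ≫ φ = φ → ∑ i, p i ≫ q i = φ → IsSplitIdem φ := by
  induction n with
  | zero =>
    intro Y _ p q φ _ hs
    exact ⟨0, 0, 0, by simp, by simpa using hs⟩
  | succ n ih =>
    intro Y hY p q φ hφ hs
    -- Replacing each p by φ ≫ p and each q by q ≫ φ keeps the sum equal to φ.
    wlog hpq : (∀ i, φ ≫ p i = p i) ∧ (∀ i, q i ≫ φ = q i) generalizing p q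
    · refine this (fun i => φ ≫ p i) (fun i => q i ≫ φ) ?_ ⟨?_, ?_⟩
      · have : φ ≫ (∑ i, p i ≫ q i) ≫ φ = φ := by rw [hs, hφ, hφ]
        simpa [Preadditive.comp_sum, Preadditive.sum_comp] using this
      · intro i; rw [reassoc_of% hφ]
      · intro i; rw [Category.assoc, hφ]
    obtain ⟨hp, hq⟩ := hpq
    rw [Fin.sum_univ_succ] at hs
    set r : X ⟶ X := ∑ i : Fin n, p i.succ ≫ q i.succ with hr
    rcases isIso_or_isIso_one_sub_of_isLocalRing (hY 0) (q 0 ≫ p 0) with h | h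
    · obtain ⟨b, hb, hb'⟩ := h
      have hb : q 0 ≫ p 0 ≫ b = 𝟙 _ := by simpa using hb
      -- The idempotent e lies under φ and has image `Y 0`. The complement φ - e kills the zeroth
      -- term, so it is a sum of n terms and splits by induction.
      obtain ⟨e, he⟩ : ∃ e : X ⟶ X, e = p 0 ≫ b ≫ q 0 := ⟨_, rfl⟩
      have hee : e ≫ e = e := by simp [he, reassoc_of% hb]
      have hφe : φ ≫ e = e := by simp [he, reassoc_of% (hp 0)]
      have heφ : e ≫ φ = e := by simp [he, hq 0]
      have h0 : q 0 ≫ (φ - e) = 0 := by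
        rw [Preadditive.comp_sub, hq, he, reassoc_of% hb, sub_self]
      have hid : (φ - e) ≫ (φ - e) = φ - e := by
        simp [hφ, hee, hφe, heφ]
      obtain ⟨W, i, π, hi, hπ⟩ := ih (fun i => Y i.succ) (fun i => hY _)
        (fun i => (φ - e) ≫ p i.succ) (fun i => q i.succ ≫ (φ - e)) (φ - e) hid (by
          have : (φ - e) ≫ (p 0 ≫ q 0 + r) ≫ (φ - e) = φ - e := by
            rw [hs, Preadditive.comp_sub φ, hφ, hφe, hid]
          rw [Preadditive.add_comp, Category.assoc, h0] at this
          simpa [hr, Preadditive.comp_sum, Preadditive.sum_comp] using this)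
      have hie : i ≫ e = 0 := by
        have : i ≫ (φ - e) ≫ e = 0 := by simp [hφe, hee]
        rwa [← hπ, Category.assoc, reassoc_of% hi] at this
      have heπ : e ≫ π = 0 := by
        have : e ≫ (φ - e) ≫ π = 0 := by
          rw [← Category.assoc, Preadditive.comp_sub, heφ, hee, sub_self, zero_comp]
        rwa [← hπ, Category.assoc, hi, Category.comp_id] at this
      have hip : i ≫ p 0 = 0 := by
        have : i ≫ e ≫ p 0 = 0 := by rw [reassoc_of% hie, zero_comp]
        have hbb : e ≫ p 0 = p 0 := by
          have : b ≫ q 0 ≫ p 0 = 𝟙 _ := hb'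
          rw [he, Category.assoc, Category.assoc, this, Category.comp_id]
        rwa [hbb] at this
      have hqπ : q 0 ≫ π = 0 := by
        have : q 0 ≫ e = q 0 := by rw [he, reassoc_of% hb]
        rw [← this, Category.assoc, heπ, comp_zero]
      refine ⟨Y 0 ⊞ W, biprod.desc (q 0) i, biprod.lift (p 0 ≫ b) π, ?_, ?_⟩
      · ext <;> simp [hb, hi, hqπ, reassoc_of% hip]
      · simp only [biprod.lift_desc, Category.assoc, hπ, ← he]
        abel
    · obtain ⟨b, hb, -⟩ := h
      have hb : (𝟙 _ - q 0 ≫ p 0) ≫ b = 𝟙 _ := hb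
      -- Here p 0 can be solved for in terms of r, which absorbs the zeroth term into the other n.
      have h1 : p 0 ≫ (𝟙 _ - q 0 ≫ p 0) = r ≫ p 0 := by
        have : φ ≫ p 0 = p 0 := hp 0
        rw [← hs, Preadditive.add_comp] at this
        rw [Preadditive.comp_sub, Category.comp_id, sub_eq_iff_eq_add', ← Category.assoc, this]
      have h2 : p 0 = r ≫ p 0 ≫ b := by
        rw [← Category.assoc, ← h1, Category.assoc, hb, Category.comp_id]
      refine ih (fun i => Y i.succ) (fun i => hY _) (fun i => p i.succ)
        (fun i => q i.succ ≫ ((p 0 ≫ b) ≫ q 0 + 𝟙 X)) φ hφ ?_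
      simp only [← Category.assoc]
      rw [← Preadditive.sum_comp, ← hr, Preadditive.comp_add, Category.comp_id, ← Category.assoc,
        ← h2, hs]

lemma KrullSchmidt.exists_sum_eq_id (h : KrullSchmidt B) (X : B) :
    ∃ (n : ℕ) (Y : Fin n → B) (p : ∀ i, X ⟶ Y i) (q : ∀ i, Y i ⟶ X),
      (∀ i, IsLocalRing (End (Y i))) ∧ ∑ i, p i ≫ q i = 𝟙 X := by
  obtain ⟨n, Y, b, hY, ⟨hb⟩, ⟨e⟩⟩ := h X
  refine ⟨n, Y, fun i => e.hom ≫ b.π i, fun i => b.ι i ≫ e.inv, hY, ?_⟩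
  have := congr_arg (fun t => e.hom ≫ t ≫ e.inv) (IsBilimit.total hb)
  simpa [Preadditive.comp_sum, Preadditive.sum_comp] using this

lemma KrullSchmidt.isSplitIdem [HasZeroObject B] [HasBinaryBiproducts B] (h : KrullSchmidt B)
    {X : B} (φ : X ⟶ X) (hφ : φ ≫ φ = φ) : IsSplitIdem φ := by
  obtain ⟨n, Y, p, q, hY, hs⟩ := h.exists_sum_eq_id X
  refine isSplitIdem_of_eq_sum n Y hY p (fun i => q i ≫ φ) φ hφ ?_
  simp only [← Category.assoc]
  rw [← Preadditive.sum_comp, hs, Category.id_comp]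

lemma KrullSchmidt.exists_iso_biprod [HasZeroObject B] [HasBinaryBiproducts B]
    (h : KrullSchmidt B) {X W : B} (i : W ⟶ X) (p : X ⟶ W) (hip : i ≫ p = 𝟙 W) :
    ∃ (Z : B) (e : X ≅ W ⊞ Z), e.hom ≫ biprod.fst = p ∧ biprod.inl ≫ e.inv = i := by
  obtain ⟨Z, j, q, hjq, hqj⟩ := h.isSplitIdem (𝟙 X - p ≫ i) (by simp [reassoc_of% hip])
  have h1 : j ≫ p = 0 := by
    have : j ≫ (𝟙 X - p ≫ i) ≫ p = 0 := by simp [hip]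
    rwa [← hqj, Category.assoc, reassoc_of% hjq] at this
  have h2 : i ≫ q = 0 := by
    have : i ≫ (𝟙 X - p ≫ i) ≫ q = 0 := by
      simp [reassoc_of% hip]
    rwa [← hqj, Category.assoc, hjq, Category.comp_id] at this
  refine ⟨Z, ⟨biprod.lift p q, biprod.desc i j, ?_, ?_⟩, ?_, ?_⟩
  · simp [hqj]
  · ext <;> simp [hip, hjq, h1, h2]
  · simp
  · simp

/-- Fitting's lemma for a finite-dimensional algebra. -/
lemma exists_fitting_idempotent (k : Type*) [Field k] {A : Type*} [Ring A] [Algebra k A]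
    [Module.Finite k A] (a : A) :
    ∃ (n : ℕ) (s e : A), n ≠ 0 ∧ Commute a s ∧ e * e = e ∧ e = s * a ^ n ∧ a ^ n * e = a ^ n := by
  classical
  have hint : IsIntegral k a := Algebra.IsIntegral.isIntegral a
  -- The extra factor X makes the multiplicity n of the root 0 positive. Write μ = Xⁿ q with q prime
  -- to X; the Bézout relation u Xⁿ + v q = 1 gives the idempotent u(a) aⁿ.
  set μ := Polynomial.X * minpoly k a with hμ
  have hμ0 : μ ≠ 0 := mul_ne_zero Polynomial.X_ne_zero (minpoly.ne_zero hint)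
  have haμ : Polynomial.aeval a μ = 0 := by simp [hμ, minpoly.aeval]
  obtain ⟨q, hq, hqX⟩ := Polynomial.exists_eq_pow_rootMultiplicity_mul_and_not_dvd μ hμ0 0
  set n := Polynomial.rootMultiplicity 0 μ with hn
  have hn0 : n ≠ 0 := by
    have : μ.IsRoot 0 := by simp [hμ]
    exact ((Polynomial.rootMultiplicity_pos hμ0).2 this).ne'
  simp only [map_zero, sub_zero] at hq hqX
  have hcop : IsCoprime (Polynomial.X ^ n) q :=
    (((Polynomial.prime_X (R := k)).irreducible.coprime_iff_not_dvd).2 hqX).pow_left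
  obtain ⟨u, v, huv⟩ := hcop
  have h1 : Polynomial.aeval a u * a ^ n + Polynomial.aeval a v * Polynomial.aeval a q = 1 := by
    simpa using congr_arg (Polynomial.aeval a) huv
  have h2 : a ^ n * Polynomial.aeval a q = 0 := by
    rw [hq] at haμ; simpa using haμ
  have hc : ∀ r t : Polynomial k, Commute (Polynomial.aeval a r) (Polynomial.aeval a t) :=
    fun r t => by
      unfold Commute SemiconjBy
      rw [← map_mul, ← map_mul, mul_comm]
  have hca : ∀ r : Polynomial k, Commute a (Polynomial.aeval a r) := fun r => by
    simpa using hc Polynomial.X r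
  have h3 : a ^ n * (Polynomial.aeval a u * a ^ n) = a ^ n := by
    rw [eq_sub_of_add_eq h1, mul_sub, mul_one, ← mul_assoc, ((hca v).pow_left n).eq, mul_assoc,
      h2, mul_zero, sub_zero]
  exact ⟨n, Polynomial.aeval a u, Polynomial.aeval a u * a ^ n, hn0, hca u,
    by rw [mul_assoc, h3], rfl, h3⟩

section

variable [HasBinaryBiproducts B]

lemma indecomposable_of_isLocalRing {X : B} (h : IsLocalRing (End X)) : Indecomposable X := by
  constructor
  · intro hX
    exact one_ne_zero (α := End X) (hX.eq_of_src _ _)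
  · intro Y Z e
    have key : ∀ {W : B} (i : W ⟶ X) (p : X ⟶ W), i ≫ p = 𝟙 W →
        IsIso (𝟙 X - p ≫ i) → IsZero W := by
      intro W i p hip hu
      obtain ⟨b, hb, -⟩ := hu
      rw [IsZero.iff_id_eq_zero]
      have h1 : i ≫ (𝟙 X - p ≫ i) = 0 := by simp [reassoc_of% hip]
      have : i = 0 := by rw [← Category.comp_id i, ← hb, reassoc_of% h1, zero_comp]
      rw [← hip, this, zero_comp]
    rcases isIso_or_isIso_one_sub_of_isLocalRing h
      (e.hom ≫ biprod.fst ≫ biprod.inl ≫ e.inv) with h | h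
    · right
      refine key (biprod.inr ≫ e.inv) (e.hom ≫ biprod.snd) (by simp) ?_
      convert h using 1
      have := congr_arg (fun t => e.hom ≫ t ≫ e.inv) (biprod.total (X := Y) (Y := Z))
      simp only [Preadditive.comp_add, Preadditive.add_comp, Category.assoc, Category.id_comp,
        e.hom_inv_id] at this
      simp [← this]
    · left
      refine key (biprod.inl ≫ e.inv) (e.hom ≫ biprod.fst) (by simp) ?_
      convert h using 1
      simp

/-- The Fitting idempotent of a splits, so indecomposability makes it 0 or 1: then a is nilpotent or
invertible, respectively. -/
lemma isIso_or_isIso_one_sub_of_indecomposable [HasZeroObject B] (k : Type*) [Field k] [Linear k B]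
    (hf : ∀ X Y : B, Module.Finite k (X ⟶ Y)) (hKS : KrullSchmidt B) {X : B}
    (hX : Indecomposable X) (a : X ⟶ X) : IsIso a ∨ IsIso (𝟙 X - a) := by
  have : Module.Finite k (End X) := hf X X
  obtain ⟨n, s, e, hn, hc, hee, he, hae⟩ := exists_fitting_idempotent k (End.of a)
  obtain ⟨W, i, p, hip, hpi⟩ := hKS.isSplitIdem (e : X ⟶ X) hee
  obtain ⟨Z, ε, hε, hε'⟩ := hKS.exists_iso_biprod i p hip
  have hunit : IsUnit (End.of a) ∨ IsUnit (1 - End.of a) := by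
    rcases hX.2 W Z ε with h | h
    · right
      have : e = 0 := by rw [← hpi, h.eq_of_src i 0, comp_zero]
      rw [this, mul_zero] at hae
      exact (IsNilpotent.isUnit_one_sub ⟨n, hae.symm⟩)
    · left
      have hpi' : p ≫ i = 𝟙 X := by
        rw [← hε, ← hε', Category.assoc]
        have h2 := biprod.total (X := W) (Y := Z)
        rw [h.eq_of_src biprod.inr 0, comp_zero, add_zero] at h2
        rw [reassoc_of% h2]; simp
      have he1 : e = 1 := by rw [← hpi, hpi']; rfl
      rw [he1] at he
      have hcn : Commute (End.of a ^ n) s := hc.pow_left n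
      exact (isUnit_pow_iff hn).1 ⟨⟨End.of a ^ n, s, by rw [hcn.eq, ← he], he.symm⟩, rfl⟩
  exact hunit.imp (isUnit_iff_isIso _).1 (isUnit_iff_isIso _).1

end

end KrullSchmidt

/-! ### `E`-triangles in the stable category. -/

namespace ExtriangulatedStructure

variable {B : Type u} [Category.{v} B] [Preadditive B] [HasZeroObject B] [HasBinaryBiproducts B]
  {𝔼 : ExtriangulatedStructure.{w} B}

instance additive_toStable : 𝔼.toStable.Additive := ⟨rfl⟩

lemma toStable_map_eq_iff {X Y : B} {f g : X ⟶ Y} :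
    𝔼.toStable.map f = 𝔼.toStable.map g ↔ 𝔼.FactorsProj (f - g) :=
  Quotient.functor_map_eq_iff 𝔼.stableRel f g

lemma toStable_map_eq_zero_iff {X Y : B} {f : X ⟶ Y} :
    𝔼.toStable.map f = 0 ↔ 𝔼.FactorsProj f := by
  rw [← 𝔼.toStable.map_zero, toStable_map_eq_iff, sub_zero]

lemma exists_toStable_map {X Y : B} (f : 𝔼.toStable.obj X ⟶ 𝔼.toStable.obj Y) :
    ∃ f' : X ⟶ Y, 𝔼.toStable.map f' = f := 𝔼.toStable.map_surjective f

lemma proj_of_retract {P W : B} (hP : 𝔼.proj P) (i : W ⟶ P) (p : P ⟶ W) (h : i ≫ p = 𝟙 W) :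
    𝔼.proj W := by
  intro A X C x y δ hT c
  obtain ⟨b, hb⟩ := hP x y δ hT (p ≫ c)
  exact ⟨i ≫ b, by rw [Category.assoc, hb, reassoc_of% h]⟩

lemma proj_of_id_factorsProj {W : B} (h : 𝔼.FactorsProj (𝟙 W)) : 𝔼.proj W := by
  obtain ⟨P, i, p, hP, hip⟩ := h
  exact proj_of_retract hP i p hip

section Triangles

variable {A X C : B} {x : A ⟶ X} {y : X ⟶ C} {δ : Ext 𝔼.E C A}

/-- A morphism factoring through a projective object lifts along deflations, up to the stable
category. -/
lemma Tri.exists_lift_of_factorsProj (h : 𝔼.Tri x y δ) {W : B} {a : W ⟶ C}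
    (ha : 𝔼.FactorsProj a) : ∃ b : W ⟶ X, b ≫ y = a ∧ 𝔼.FactorsProj b := by
  obtain ⟨P, a, c, hP, rfl⟩ := ha
  obtain ⟨b, hb⟩ := hP x y δ h c
  exact ⟨a ≫ b, by rw [Category.assoc, hb], P, a, b, hP, rfl⟩

/-- The use of E(𝓣, 𝓟) = 0: pushing δ to the projective object kills it, so the map to that object
extends. -/
lemma Tri.exists_extend_of_factorsProj (h : 𝔼.Tri x y δ)
    (hC : ∀ P : B, 𝔼.proj P → ∀ ε : Ext 𝔼.E C P, ε = 0) {Y : B} {a : A ⟶ Y}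
    (ha : 𝔼.FactorsProj a) : ∃ m : X ⟶ Y, x ≫ m = a := by
  obtain ⟨P, a, c, hP, rfl⟩ := ha
  obtain ⟨b, hb⟩ := h.exists_extend a (hC P hP _)
  exact ⟨b ≫ c, by rw [reassoc_of% hb]⟩

lemma Tri.isIso_stable_right (h : 𝔼.Tri x y δ) (c : C ⟶ C) (hc : pull c δ = δ)
    (hy : 𝔼.toStable.map (y ≫ c) = 𝔼.toStable.map y) : IsIso (𝔼.toStable.map c) := by
  obtain ⟨z, hz⟩ := h.exists_coextend (c - 𝟙 C) (by rw [sub_pull, hc]; simp)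
  refine isIso_of_sq_zero _ ?_
  have h1 : 𝔼.toStable.map c - 𝟙 _ = 𝔼.toStable.map z ≫ 𝔼.toStable.map y := by
    rw [← Functor.map_comp, hz, Functor.map_sub, 𝔼.toStable.map_id]
  nth_rewrite 1 [h1]
  rw [Category.assoc, Preadditive.comp_sub, ← Functor.map_comp, hy]
  simp

/-- If the inflation `x` is stably right minimal and morphisms factoring through projectives
extend along it, then endomorphisms of the cone fixing the deflation stably are stable
isomorphisms. -/
lemma Tri.isIso_stable_of_rightMinimal (h : 𝔼.Tri x y δ)
    (hext : ∀ (Y : B) (a : A ⟶ Y), 𝔼.FactorsProj a → ∃ m : X ⟶ Y, 𝔼.FactorsProj m ∧ x ≫ m = a)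
    (hmin : RightMinimal (𝔼.toStable.map x)) (e : C ⟶ C)
    (he : 𝔼.toStable.map (y ≫ e) = 𝔼.toStable.map y) : IsIso (𝔼.toStable.map e) := by
  -- Correcting the identity of X by a stably trivial b₀ makes the square with e commute strictly,
  -- so e extends to an endomorphism of the triangle.
  obtain ⟨b₀, hb₀, hb₀'⟩ := h.exists_lift_of_factorsProj (toStable_map_eq_iff.1 he)
  obtain ⟨ρ, hρ, hρδ⟩ := 𝔼.et3_op h h (𝟙 X + b₀) e (by
    rw [Preadditive.add_comp, hb₀, Category.id_comp]; abel)
  have hρx : 𝔼.toStable.map ρ ≫ 𝔼.toStable.map x = 𝔼.toStable.map x := by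
    rw [← Functor.map_comp, ← hρ, Functor.map_comp, Functor.map_add,
      toStable_map_eq_zero_iff.2 hb₀']
    simp
  have hiso := hmin _ hρx
  obtain ⟨σ, hσ⟩ := exists_toStable_map (inv (𝔼.toStable.map ρ))
  have hσx : 𝔼.toStable.map (σ ≫ x) = 𝔼.toStable.map x := by
    rw [Functor.map_comp, hσ, IsIso.inv_comp_eq, hρx]
  obtain ⟨m, hm, hxm⟩ := hext _ _ (toStable_map_eq_iff.1 hσx)
  obtain ⟨e', he', hσδ⟩ := 𝔼.et3 h h σ (𝟙 X + m) (by
    rw [Preadditive.comp_add, hxm, Category.comp_id]; abel)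
  have hye' : 𝔼.toStable.map (y ≫ e') = 𝔼.toStable.map y := by
    rw [he', Functor.map_comp, Functor.map_add, toStable_map_eq_zero_iff.2 hm]
    simp
  -- The inverse of ρ exists only stably; this makes the composites of e and e' fix δ exactly.
  have key : ∀ τ : A ⟶ A, 𝔼.toStable.map τ = 𝟙 _ → push τ δ = δ := by
    intro τ hτ
    obtain ⟨m, -, hm⟩ := hext _ (τ - 𝟙 A) (toStable_map_eq_iff.1 (by simpa using hτ))
    have := h.push_comp_eq_zero m
    rwa [hm, sub_push, push_id, sub_eq_zero] at this
  refine isIso_of_isIso_comp _ (𝔼.toStable.map e') ?_ ?_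
  · rw [← Functor.map_comp]
    refine h.isIso_stable_right _ ?_ ?_
    · rw [pull_comp, ← hσδ, ← push_pull, ← hρδ, ← push_comp]
      exact key _ (by rw [Functor.map_comp, hσ, IsIso.hom_inv_id])
    · rw [← Category.assoc, Functor.map_comp, he, ← Functor.map_comp, hye']
  · rw [← Functor.map_comp]
    refine h.isIso_stable_right _ ?_ ?_
    · rw [pull_comp, ← hρδ, ← push_pull, ← hσδ, ← push_comp]
      exact key _ (by rw [Functor.map_comp, hσ, IsIso.inv_hom_id])
    · rw [← Category.assoc, Functor.map_comp, hye', ← Functor.map_comp, he]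

end Triangles

/-! ### Syzygies of 𝓣, approximations and the construction of diagrams. -/

section Subcategory

variable {𝓣 : ObjectProperty B}

lemma Diagram.exists_extend {A : B} (D : 𝔼.Diagram 𝓣 A)
    (hTP : ∀ T P : B, 𝓣 T → 𝔼.proj P → ∀ δ : Ext 𝔼.E T P, δ = 0) {Y : B} {a : D.R₁ ⟶ Y}
    (ha : 𝔼.FactorsProj a) : ∃ m : D.P ⟶ Y, D.f ≫ D.r ≫ m = a := by
  obtain ⟨m, hm⟩ := D.tri_colRight.exists_extend_of_factorsProj (fun P => hTP _ P D.mem_T₁) ha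
  exact ⟨m, by rw [← hm, ← D.comm_upper, Category.assoc]⟩

lemma Diagram.syzygy_R₁ {A : B} (D : 𝔼.Diagram 𝓣 A) : 𝔼.syzygy 𝓣 D.R₁ :=
  ⟨_, _, _, _, _, D.proj_P, D.mem_T₁, D.tri_colRight⟩

lemma Diagram.syzygy_R₂ {A : B} (D : 𝔼.Diagram 𝓣 A) : 𝔼.syzygy 𝓣 D.R₂ :=
  ⟨_, _, _, _, _, D.proj_P, D.mem_T₂, D.tri_rowTop⟩

lemma Diagram.isIso_stable_of_rightMinimal {A : B} (D : 𝔼.Diagram 𝓣 A)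
    (hTP : ∀ T P : B, 𝓣 T → 𝔼.proj P → ∀ δ : Ext 𝔼.E T P, δ = 0)
    (hmin : RightMinimal (𝔼.toStable.map D.f)) (e : A ⟶ A)
    (he : 𝔼.toStable.map (D.g ≫ e) = 𝔼.toStable.map D.g) : IsIso (𝔼.toStable.map e) := by
  refine D.tri_colLeft.isIso_stable_of_rightMinimal (fun Y a ha => ?_) hmin e he
  obtain ⟨m, hm⟩ := D.exists_extend hTP ha
  exact ⟨D.r ≫ m, ⟨D.P, D.r, m, D.proj_P, rfl⟩, hm⟩

/-- A morphism from `D.R₂` that stably kills `D.f` factors stably through `D.g`. -/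
lemma Diagram.exists_stable_desc {A : B} (D : 𝔼.Diagram 𝓣 A)
    (hTP : ∀ T P : B, 𝓣 T → 𝔼.proj P → ∀ δ : Ext 𝔼.E T P, δ = 0) {Y : B} (b : D.R₂ ⟶ Y)
    (hb : 𝔼.toStable.map (D.f ≫ b) = 0) :
    ∃ c : A ⟶ Y, 𝔼.toStable.map (D.g ≫ c) = 𝔼.toStable.map b := by
  obtain ⟨m, hm⟩ := D.exists_extend hTP (toStable_map_eq_zero_iff.1 hb)
  obtain ⟨c, hc⟩ := D.tri_colLeft.exists_desc (b - D.r ≫ m) (by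
    rw [Preadditive.comp_sub, hm, sub_self])
  refine ⟨c, ?_⟩
  rw [hc, toStable_map_eq_iff]
  have : 𝔼.FactorsProj (D.r ≫ m) := ⟨D.P, D.r, m, D.proj_P, rfl⟩
  simpa using this.neg

lemma of_retract (hKS : KrullSchmidt B) [𝓣.IsClosedUnderIsomorphisms]
    (hSummand : ∀ X Y : B, 𝓣 (X ⊞ Y) → 𝓣 X) {T W : B} (hT : 𝓣 T) (i : W ⟶ T) (p : T ⟶ W)
    (hip : i ≫ p = 𝟙 W) : 𝓣 W := by
  obtain ⟨Z, e, -⟩ := hKS.exists_iso_biprod i p hip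
  exact hSummand W Z (𝓣.prop_of_iso e hT)

/-- `Ω 𝓣` is closed under direct summands. -/
lemma syzygy_of_retract (k : Type*) [Field k] [Linear k B]
    (hf : ∀ X Y : B, Module.Finite k (X ⟶ Y)) (hKS : KrullSchmidt B)
    [𝓣.IsClosedUnderIsomorphisms] (hSummand : ∀ X Y : B, 𝓣 (X ⊞ Y) → 𝓣 X)
    (hTP : ∀ T P : B, 𝓣 T → 𝔼.proj P → ∀ δ : Ext 𝔼.E T P, δ = 0) {R R' : B}
    (hR : 𝔼.syzygy 𝓣 R) (i : R' ⟶ R) (p : R ⟶ R') (hip : i ≫ p = 𝟙 R') : 𝔼.syzygy 𝓣 R' := by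
  obtain ⟨P, T, x, y, δ, hP, hT, h⟩ := hR
  -- The idempotent p ≫ i of R extends to the triangle, but the induced c on T need not be
  -- idempotent. Its Fitting idempotent e acts on δ in the same way, and the image of e is the
  -- required object of 𝓣.
  obtain ⟨b, hb⟩ := h.exists_extend ((p ≫ i) ≫ x) (hTP T P hT hP _)
  obtain ⟨c, -, hc⟩ := 𝔼.et3 h h (p ≫ i) b hb
  have : Module.Finite k (End T) := hf T T
  obtain ⟨n, s, e, hn, hcs, hee, he, hce⟩ := exists_fitting_idempotent k (End.of c)
  have hpush : push (p ≫ i) (push (p ≫ i) δ) = push (p ≫ i) δ := by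
    rw [← push_comp]; simp [reassoc_of% hip]
  have hpow : ∀ m : ℕ, pull ((End.of c ^ (m + 1) : End T) : T ⟶ T) δ = push (p ≫ i) δ := by
    intro m
    induction m with
    | zero => rw [zero_add, pow_one]; exact hc.symm
    | succ m ih =>
      have : pull (End.of c ≫ (End.of c ^ (m + 1) : End T)) δ = push (p ≫ i) δ := by
        rw [pull_comp, ih, ← push_pull]
        exact (congr_arg _ hc.symm).trans hpush
      rw [pow_succ]; exact this
  obtain ⟨n, rfl⟩ := Nat.exists_eq_succ_of_ne_zero hn
  have h₁ : push (p ≫ i) (pull (e : T ⟶ T) δ) = push (p ≫ i) δ := by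
    have : pull ((e : T ⟶ T) ≫ (End.of c ^ (n + 1) : End T)) δ = push (p ≫ i) δ :=
      (congr_arg (fun t : T ⟶ T => pull t δ) hce).trans (hpow n)
    rwa [pull_comp, hpow, ← push_pull] at this
  have h₂ : pull (e : T ⟶ T) δ = push (p ≫ i) (pull (s : T ⟶ T) δ) := by
    have : (e : T ⟶ T) = (s : T ⟶ T) ≫ (End.of c ^ (n + 1) : End T) :=
      he.trans (hcs.pow_left (n + 1)).eq.symm
    rw [this, pull_comp, hpow, ← push_pull]
  have h₃ : pull (e : T ⟶ T) δ = push (p ≫ i) δ := by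
    rw [← h₁, h₂, ← push_comp]; simp [reassoc_of% hip]
  obtain ⟨T', j, q, hjq, hqj⟩ := hKS.isSplitIdem (e : T ⟶ T) hee
  obtain ⟨M, x', y', h'⟩ := 𝔼.exists_tri (push p (pull j δ))
  have hpi : push p (push (p ≫ i) δ) = push p δ := by
    rw [← push_comp, Category.assoc, hip, Category.comp_id]
  obtain ⟨β, hβ, hβ'⟩ := 𝔼.realize h' h i j (by
    rw [← push_comp, push_pull, ← h₃, ← pull_comp, ← hqj, reassoc_of% hjq])
  obtain ⟨γ, hγ, hγ'⟩ := 𝔼.realize h h' p q (by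
    rw [← push_pull, ← pull_comp, hqj, h₃, hpi])
  -- The composite is the identity at both ends, so M is a retract of P and hence projective.
  have hiso : IsIso (β ≫ γ) := h'.isIso_middle _
    (by rw [reassoc_of% hβ, hγ, reassoc_of% hip])
    (by rw [Category.assoc, ← hγ', ← reassoc_of% hβ', hjq, Category.comp_id])
  refine ⟨M, T', x', y', _, proj_of_retract hP β (γ ≫ inv (β ≫ γ)) ?_,
    of_retract hKS hSummand hT j q hjq, h'⟩
  rw [← Category.assoc, IsIso.hom_inv_id]

/-- Every morphism has a stably right minimal restriction to a direct summand. -/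
lemma exists_rightMinimal (k : Type*) [Field k] [Linear k B]
    (hf : ∀ X Y : B, Module.Finite k (X ⟶ Y)) (hKS : KrullSchmidt B) {Y : B} (n : ℕ) :
    ∀ (X : B) (f : X ⟶ Y), Module.finrank k (X ⟶ X) = n →
      ∃ (W : B) (i : W ⟶ X) (p : X ⟶ W), i ≫ p = 𝟙 W ∧
        RightMinimal (𝔼.toStable.map (i ≫ f)) ∧
        𝔼.toStable.map (p ≫ i ≫ f) = 𝔼.toStable.map f := by
  induction n using Nat.strong_induction_on with
  | _ n ih =>
  intro X f hX
  by_cases hmin : RightMinimal (𝔼.toStable.map f)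
  · exact ⟨X, 𝟙 X, 𝟙 X, by simp, by simpa using hmin, by simp⟩
  simp only [RightMinimal, not_forall] at hmin
  obtain ⟨ρ, hρ, hρ'⟩ := hmin
  obtain ⟨ρ, rfl⟩ := exists_toStable_map ρ
  have : Module.Finite k (End X) := hf X X
  -- The idempotent e fixes f stably, and e ≠ 1 because ρ is not invertible; its image therefore has
  -- a smaller endomorphism algebra.
  obtain ⟨m, s, e, hm, hc, hee, he, hae⟩ := exists_fitting_idempotent k (End.of ρ)
  have hpow : ∀ l : ℕ, 𝔼.toStable.map ((End.of ρ ^ l : End X) : X ⟶ X) ≫ 𝔼.toStable.map f =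
      𝔼.toStable.map f := by
    intro l
    induction l with
    | zero =>
      rw [pow_zero]
      exact (congr_arg (· ≫ _) (𝔼.toStable.map_id X)).trans (Category.id_comp _)
    | succ l ihl =>
      rw [pow_succ]
      refine (congr_arg (· ≫ _) (𝔼.toStable.map_comp ρ (End.of ρ ^ l : End X))).trans ?_
      rw [Category.assoc, ihl, hρ]
  have hef : 𝔼.toStable.map (e : X ⟶ X) ≫ 𝔼.toStable.map f = 𝔼.toStable.map f := by
    have h1 : 𝔼.toStable.map (e : X ⟶ X) ≫ 𝔼.toStable.map ((End.of ρ ^ m : End X) : X ⟶ X) =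
        𝔼.toStable.map ((End.of ρ ^ m : End X) : X ⟶ X) := by
      rw [← Functor.map_comp]; exact congr_arg _ hae
    calc _ = 𝔼.toStable.map (e : X ⟶ X) ≫
          𝔼.toStable.map ((End.of ρ ^ m : End X) : X ⟶ X) ≫ 𝔼.toStable.map f := by rw [hpow]
      _ = _ := by rw [← Category.assoc, h1, hpow]
  obtain ⟨W, i, p, hip, hpi⟩ := hKS.isSplitIdem (e : X ⟶ X) hee
  have hne : p ≫ i ≠ 𝟙 X := by
    intro h1
    have he1 : e = 1 := hpi.symm.trans h1
    rw [he1] at he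
    have hcn : Commute (End.of ρ ^ m) s := hc.pow_left m
    have : IsUnit (End.of ρ) :=
      (isUnit_pow_iff hm).1 ⟨⟨End.of ρ ^ m, s, by rw [hcn.eq, ← he], he.symm⟩, rfl⟩
    have : IsIso ρ := (isUnit_iff_isIso _).1 this
    exact hρ' inferInstance
  have hlt : Module.finrank k (W ⟶ W) < n := by
    let L : (W ⟶ W) →ₗ[k] (X ⟶ X) :=
      { toFun := fun φ => p ≫ φ ≫ i
        map_add' := fun φ ψ => by simp
        map_smul' := fun c φ => by simp }
    have hL : Function.Injective L := by
      intro φ ψ h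
      have : i ≫ (p ≫ φ ≫ i) ≫ p = i ≫ (p ≫ ψ ≫ i) ≫ p := congr_arg (fun t => i ≫ t ≫ p) h
      simpa [hip, reassoc_of% hip] using this
    have := hf X X
    rw [← hX, ← LinearMap.finrank_range_of_inj hL]
    refine Submodule.finrank_lt (fun htop => ?_)
    obtain ⟨φ, hφ⟩ := LinearMap.range_eq_top.1 htop (𝟙 X)
    have hφ : p ≫ φ ≫ i = 𝟙 X := hφ
    apply hne
    rw [← Category.comp_id (p ≫ i), ← hφ]
    simp [reassoc_of% hip]
  obtain ⟨W', i', p', hip', hmin', hf'⟩ := ih _ hlt W (i ≫ f) rfl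
  refine ⟨W', i' ≫ i, p ≫ p', by simp [reassoc_of% hip, hip'], by simpa using hmin', ?_⟩
  simp only [Category.assoc]
  rw [Functor.map_comp, hf', ← Functor.map_comp, ← Category.assoc, hpi, Functor.map_comp, hef]

/-- Every object `X` is the end of an `E`-triangle whose deflation is a right approximation
of `X` by an object of `Ω 𝓣` in the stable category. -/
lemma exists_approximation (hProj : 𝔼.EnoughProjectives) (hInj : 𝔼.EnoughInjectives)
    (hFin : ContravariantlyFinite 𝓣) (X : B) :
    ∃ (K R₀ : B) (d : K ⟶ R₀) (e : R₀ ⟶ X) (ε : Ext 𝔼.E X K), 𝔼.Tri d e ε ∧ 𝔼.syzygy 𝓣 R₀ ∧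
      ∀ (R : B) (a : R ⟶ X), 𝔼.syzygy 𝓣 R →
        ∃ b : R ⟶ R₀, 𝔼.toStable.map (b ≫ e) = 𝔼.toStable.map a := by
  obtain ⟨I, C, x, y, δ, hI, h⟩ := hInj X
  obtain ⟨T₀, φ, hT₀, hφ⟩ := hFin C
  obtain ⟨U, u, v, hU⟩ := 𝔼.exists_tri (pull φ δ)
  obtain ⟨K, P', κ, π, εK, hP', hK⟩ := hProj U
  -- U is the pullback of the injective hull sequence of X along the approximation T₀ → C. Composing
  -- a projective cover of U with U → T₀ exhibits G as a syzygy of T₀ that maps onto X.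
  obtain ⟨G, h', d, e, δ'', -, -, hG, hde, hδ'', -⟩ := 𝔼.et4_op hK hU
  refine ⟨K, G, d, e, _, hde, ⟨P', T₀, h', π ≫ v, δ'', hP', hT₀, hG⟩, ?_⟩
  rintro R a ⟨P, T, x₂, y₂, ε, hP, hT, hR⟩
  obtain ⟨M, m, m', hM⟩ := 𝔼.exists_tri (push a ε)
  -- Injectivity of I turns the extension `push a ε` into a pullback of δ along some T → C, which
  -- then factors through T₀.
  obtain ⟨b, hb⟩ := hI m m' _ hM x
  obtain ⟨c, -, hc⟩ := 𝔼.et3 hM h (𝟙 X) b (by rw [hb, Category.id_comp])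
  obtain ⟨s, rfl⟩ := hφ T c hT
  obtain ⟨b₂, hb₂⟩ := hP _ _ _ hG (y₂ ≫ s)
  obtain ⟨r, -, hr⟩ := 𝔼.et3_op hR hG b₂ s hb₂.symm
  refine ⟨r, ?_⟩
  -- Both r ≫ e and a push ε to the same extension, so their difference factors through P.
  obtain ⟨m, hm⟩ := hR.exists_extend (r ≫ e - a) (by
    rw [sub_push, push_comp, hr, push_pull, hδ'', ← pull_comp, ← hc, push_id, sub_self])
  exact toStable_map_eq_iff.2 ⟨P, x₂, m, hP, hm⟩

/-- A projective cover of T₁ composed with t supplies the rest of the diagram. The map e is an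
identity; it spares an equality of objects. -/
lemma exists_diagram_of_tri (hProj : 𝔼.EnoughProjectives) {A T₁ T₂ : B} {h : A ⟶ T₁} {t : T₁ ⟶ T₂}
    {ε : Ext 𝔼.E T₂ A} (hT : 𝔼.Tri h t ε) (hT₁ : 𝓣 T₁) (hT₂ : 𝓣 T₂) :
    ∃ (D : 𝔼.Diagram 𝓣 A) (e : T₁ ⟶ D.T₁), D.h = h ≫ e := by
  obtain ⟨R₁, P, i, p, δ₁, hP, hR₁⟩ := hProj T₁
  obtain ⟨R₂, r, f, g, δ'', h₁, h₂, h₃, h₄, h₅, -⟩ := 𝔼.et4_op hR₁ hT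
  exact ⟨{ f := f, g := g, i := i, p := p, r := r, q := p ≫ t, h := h, t := t,
           colLeft := _, colRight := δ₁, rowTop := δ'', rowBot := ε, tri_colLeft := h₄,
           tri_colRight := hR₁, tri_rowTop := h₃, tri_rowBot := hT, comm_upper := h₁,
           comm_left := h₂.symm, comm_right := rfl, push_rowTop := h₅, pull_colRight := rfl,
           mem_T₁ := hT₁, mem_T₂ := hT₂, proj_P := hP }, 𝟙 _, (Category.comp_id _).symm⟩

/-- Every morphism of `Ω 𝓣` is stably the morphism `f` of a diagram. -/
lemma exists_diagram [𝓣.IsClosedUnderIsomorphisms]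
    (hSum : ∀ X Y : B, 𝓣 X → 𝓣 Y → 𝓣 (X ⊞ Y)) (hP : 𝔼.proj ≤ 𝓣)
    (hTP : ∀ T P : B, 𝓣 T → 𝔼.proj P → ∀ δ : Ext 𝔼.E T P, δ = 0) {R₁ R₂ : B}
    (hR₁ : 𝔼.syzygy 𝓣 R₁) (hR₂ : 𝔼.syzygy 𝓣 R₂) (f : R₁ ⟶ R₂) :
    ∃ (A : B) (D : 𝔼.Diagram 𝓣 A) (e₁ : 𝔼.toStable.obj D.R₁ ≅ 𝔼.toStable.obj R₁)
      (e₂ : 𝔼.toStable.obj D.R₂ ≅ 𝔼.toStable.obj R₂),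
      𝔼.toStable.map D.f ≫ e₂.hom = e₁.hom ≫ 𝔼.toStable.map f := by
  obtain ⟨P₁, T₁, x₁, y₁, δ₁, hP₁, hT₁, h₁⟩ := hR₁
  obtain ⟨P₂, T₂, x₂, y₂, δ₂, hP₂, hT₂, h₂⟩ := hR₂
  -- Adding the projective P₁ to the target turns f into an inflation without changing it stably.
  obtain ⟨A, g, ε, hA⟩ := h₁.exists_tri_lift f
  obtain ⟨y', δ', h'⟩ := h₂.sum_trivial_right P₁
  obtain ⟨G, p, h, t, δ'', c₁, c₂, hG, hAG, c₃, -⟩ := 𝔼.et4 hA h'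
  obtain ⟨m, hm⟩ := h₁.exists_extend (f ≫ x₂) (hTP _ _ hT₁ hP₂ _)
  -- The composite R₁ → P₂ ⊞ P₁ is also x₁ followed by the graph of m, so its cone is an extension
  -- of P₂ by T₁ with zero class, and lies in 𝓣.
  obtain ⟨G', p', d', e', ε', -, -, hG', hTG, -⟩ := 𝔼.et4 h₁ (tri_graph m)
  obtain ⟨j₁⟩ := hTG.nonempty_iso_biprod (push_zero _)
  have hcomp : x₁ ≫ biprod.lift m (𝟙 P₁) = biprod.lift f x₁ ≫ biprod.map x₂ (𝟙 P₁) := by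
    ext <;> simp [hm]
  rw [hcomp] at hG'
  obtain ⟨j₂⟩ := hG.nonempty_iso_cone hG'
  have hTG : 𝓣 G := 𝓣.prop_of_iso (j₂ ≪≫ j₁).symm (hSum _ _ hT₁ (hP _ hP₂))
  refine ⟨A, { f := biprod.lift f x₁, g := g, i := _, p := p, r := biprod.map x₂ (𝟙 P₁),
               q := y', h := h, t := t, colLeft := ε, colRight := δ'', rowTop := δ',
               rowBot := _, tri_colLeft := hA, tri_colRight := hG, tri_rowTop := h',
               tri_rowBot := hAG, comm_upper := rfl, comm_left := c₁, comm_right := c₂,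
               push_rowTop := rfl, pull_colRight := c₃, mem_T₁ := hTG,
               mem_T₂ := hSum _ _ hT₂ (hP _ proj_zero), proj_P := proj_biprod hP₂ hP₁ },
    Iso.refl _, ⟨𝔼.toStable.map biprod.fst, 𝔼.toStable.map biprod.inl, ?_, ?_⟩, ?_⟩
  · rw [← Functor.map_comp]
    refine (toStable_map_eq_iff.2 ?_).trans (𝔼.toStable.map_id _)
    refine ⟨P₁, -biprod.snd, biprod.inr, hP₁, ?_⟩
    rw [← biprod.total, Preadditive.neg_comp]; abel
  · rw [← Functor.map_comp, biprod.inl_fst, 𝔼.toStable.map_id]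
  · rw [← Functor.map_comp, biprod.lift_fst]; simp

end Subcategory

end ExtriangulatedStructure

/-! ### The functor H, evaluated objectwise. -/

lemma exact_of_evaluation {J : Type u} [Category.{v} J]
    (S : ShortComplex (J ⥤ AddCommGrpCat.{v}))
    (h : ∀ j, (S.map ((evaluation _ _).obj j)).Exact) : S.Exact := by
  rw [ShortComplex.exact_iff_isZero_homology, Functor.isZero_iff]
  exact fun j => ((ShortComplex.exact_iff_isZero_homology _).1 (h j)).of_iso
    (S.mapHomologyIso ((evaluation _ _).obj j)).symm

namespace ExtriangulatedStructure

variable {B : Type u} [Category.{v} B] [Preadditive B] [HasZeroObject B] [HasBinaryBiproducts B]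
  {𝔼 : ExtriangulatedStructure.{w} B} {𝓣 : ObjectProperty B}

/-- The restriction of a representable functor to `Ω 𝓣` at an object of `Ω 𝓣`. -/
def yonedaIsoH (R : 𝔼.SyzygyCat 𝓣) : preadditiveYoneda.obj R ≅ (𝔼.H 𝓣).obj R.obj :=
  NatIso.ofComponents (fun R' => AddEquiv.toAddCommGrpIso
    { toFun := fun (f : R'.unop ⟶ R) => (f.hom : R'.unop.obj ⟶ R.obj)
      invFun := fun (f : R'.unop.obj ⟶ R.obj) => (ObjectProperty.homMk f : R'.unop ⟶ R)
      left_inv := fun _ => rfl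
      right_inv := fun _ => rfl
      map_add' := fun _ _ => rfl }) (by intros; rfl)

lemma yoneda_map_comp_yonedaIsoH {R R' : 𝔼.SyzygyCat 𝓣} (f : R ⟶ R') :
    preadditiveYoneda.map f ≫ (yonedaIsoH R').hom =
      (yonedaIsoH R).hom ≫ (𝔼.H 𝓣).map f.hom := rfl

section Evaluation

variable {X Y Z R R' : 𝔼.Stable}

/-- The component of a morphism `H X ⟶ H Y` at an object `R` of `Ω 𝓣`. -/
def evalH (α : (𝔼.H 𝓣).obj X ⟶ (𝔼.H 𝓣).obj Y) (hR : 𝔼.stableSyzygy 𝓣 R) (z : R ⟶ X) : R ⟶ Y :=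
  α.app (op ⟨R, hR⟩) z

@[simp] lemma evalH_map (f : X ⟶ Y) (hR : 𝔼.stableSyzygy 𝓣 R) (z : R ⟶ X) :
    evalH ((𝔼.H 𝓣).map f) hR z = z ≫ f := rfl

lemma comp_evalH (α : (𝔼.H 𝓣).obj X ⟶ (𝔼.H 𝓣).obj Y) (hR : 𝔼.stableSyzygy 𝓣 R)
    (hR' : 𝔼.stableSyzygy 𝓣 R') (a : R ⟶ R') (z : R' ⟶ X) :
    evalH α hR (a ≫ z) = a ≫ evalH α hR' z := by
  let a' : (⟨R, hR⟩ : 𝔼.SyzygyCat 𝓣) ⟶ ⟨R', hR'⟩ := ObjectProperty.homMk a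
  exact ConcreteCategory.congr_hom (α.naturality a'.op) z

@[simp] lemma evalH_zero (α : (𝔼.H 𝓣).obj X ⟶ (𝔼.H 𝓣).obj Y) (hR : 𝔼.stableSyzygy 𝓣 R) :
    evalH α hR (0 : R ⟶ X) = 0 := map_zero (α.app (op ⟨R, hR⟩)).hom

lemma evalH_sum (α : (𝔼.H 𝓣).obj X ⟶ (𝔼.H 𝓣).obj Y) (hR : 𝔼.stableSyzygy 𝓣 R) {n : ℕ}
    (z : Fin n → (R ⟶ X)) : evalH α hR (∑ i, z i) = ∑ i, evalH α hR (z i) :=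
  map_sum (α.app (op ⟨R, hR⟩)).hom z Finset.univ

lemma H_hom_ext {α β : (𝔼.H 𝓣).obj X ⟶ (𝔼.H 𝓣).obj Y}
    (h : ∀ (R : 𝔼.Stable) (hR : 𝔼.stableSyzygy 𝓣 R) (z : R ⟶ X), evalH α hR z = evalH β hR z) :
    α = β := by
  ext R z
  exact h R.unop.obj R.unop.property z

lemma H_map_eq_zero_iff (f : X ⟶ Y) : (𝔼.H 𝓣).map f = 0 ↔
    ∀ R : 𝔼.Stable, 𝔼.stableSyzygy 𝓣 R → ∀ z : R ⟶ X, z ≫ f = 0 :=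
  ⟨fun h R hR z => by rw [← evalH_map f hR, h]; rfl, fun h => H_hom_ext fun R hR z => h R hR z⟩

lemma isZero_H_obj (h : ∀ R : 𝔼.Stable, 𝔼.stableSyzygy 𝓣 R → ∀ z : R ⟶ X, z = 0) :
    IsZero ((𝔼.H 𝓣).obj X) := by
  rw [IsZero.iff_id_eq_zero]
  exact H_hom_ext fun R hR z => h R hR z

end Evaluation

/-! ### Presentations of H(X) by objects of Ω𝓣. -/

variable (𝓣) in
/-- `R₁ ⟶ R₂ ⟶ X` becomes a right exact sequence after applying the functor `H`. -/
structure IsPresentation {R₁ R₂ X : 𝔼.Stable} (f : R₁ ⟶ R₂) (u : R₂ ⟶ X) : Prop where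
  surj : ∀ R : 𝔼.Stable, 𝔼.stableSyzygy 𝓣 R → ∀ z : R ⟶ X, ∃ a : R ⟶ R₂, a ≫ u = z
  zero : f ≫ u = 0
  exact : ∀ R : 𝔼.Stable, 𝔼.stableSyzygy 𝓣 R → ∀ a : R ⟶ R₂, a ≫ u = 0 → ∃ b : R ⟶ R₁, b ≫ f = a

namespace IsPresentation

variable {R₁ R₂ X : 𝔼.Stable} {f : R₁ ⟶ R₂} {u : R₂ ⟶ X}

lemma transport (h : IsPresentation 𝓣 f u) {R₁' R₂' : 𝔼.Stable} {f' : R₁' ⟶ R₂'} (e : R₂ ≅ R₂')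
    (a : R₁' ⟶ R₁) (ha : a ≫ f ≫ e.hom = f') (b : R₁ ⟶ R₁') (hb : b ≫ f' = f ≫ e.hom) :
    IsPresentation 𝓣 f' (e.inv ≫ u) where
  surj R hR z := by
    obtain ⟨c, hc⟩ := h.surj R hR z
    exact ⟨c ≫ e.hom, by simpa using hc⟩
  zero := by simp [← ha, h.zero]
  exact R hR c hc := by
    obtain ⟨d, hd⟩ := h.exact R hR (c ≫ e.inv) (by simpa using hc)
    exact ⟨d ≫ b, by rw [Category.assoc, hb, reassoc_of% hd]; simp⟩

lemma nonempty_isColimit (h : IsPresentation 𝓣 f u)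
    (hw : (𝔼.H 𝓣).map f ≫ (𝔼.H 𝓣).map u = 0) :
    Nonempty (IsColimit (CokernelCofork.ofπ ((𝔼.H 𝓣).map u) hw)) := by
  let S := ShortComplex.mk ((𝔼.H 𝓣).map f) ((𝔼.H 𝓣).map u) hw
  have hS : S.Exact := exact_of_evaluation S fun R => by
    rw [ShortComplex.ab_exact_iff]
    exact fun a ha => h.exact _ R.unop.property a ha
  have : Epi S.g := by
    rw [NatTrans.epi_iff_epi_app]
    exact fun R => (AddCommGrpCat.epi_iff_surjective _).2 fun z => h.surj _ R.unop.property z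
  exact ⟨hS.gIsCokernel⟩

lemma map_comp_map (h : IsPresentation 𝓣 f u) : (𝔼.H 𝓣).map f ≫ (𝔼.H 𝓣).map u = 0 := by
  rw [← Functor.map_comp, H_map_eq_zero_iff]
  intro R _ z
  rw [h.zero, comp_zero]

lemma nonempty_iso {R₁ R₂ : 𝔼.SyzygyCat 𝓣} {f : R₁ ⟶ R₂} {u : R₂.obj ⟶ X}
    (h : IsPresentation 𝓣 f.hom u) :
    Nonempty ((𝔼.H 𝓣).obj X ≅ cokernel (preadditiveYoneda.map f)) := by
  obtain ⟨hc⟩ := h.nonempty_isColimit h.map_comp_map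
  exact ⟨hc.coconePointUniqueUpToIso (colimit.isColimit _) ≪≫
    (cokernel.mapIso _ _ (yonedaIsoH R₁) (yonedaIsoH R₂) (yoneda_map_comp_yonedaIsoH f)).symm⟩

/-- If `H` is full, morphisms that kill `f` factor through the presented object. -/
lemma exists_desc (h : IsPresentation 𝓣 f u) [(𝔼.H 𝓣).Full] (hR₂ : 𝔼.stableSyzygy 𝓣 R₂)
    {A : 𝔼.Stable} (w : R₂ ⟶ A) (hw : f ≫ w = 0) : ∃ s : X ⟶ A, u ≫ s = w := by
  obtain ⟨hc⟩ := h.nonempty_isColimit h.map_comp_map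
  obtain ⟨σ, hσ⟩ := CokernelCofork.IsColimit.desc' hc ((𝔼.H 𝓣).map w) (by
    rw [← Functor.map_comp, H_map_eq_zero_iff]
    intro R _ z
    rw [hw, comp_zero])
  obtain ⟨s, rfl⟩ := (𝔼.H 𝓣).map_surjective σ
  refine ⟨s, ?_⟩
  have := congr_arg (fun α => evalH α hR₂ (𝟙 R₂)) hσ
  change (𝟙 R₂ ≫ u) ≫ s = 𝟙 R₂ ≫ w at this
  simpa using this

/-- If `H` is full, the cokernel presentation of an object in its image is induced by a
morphism. -/
lemma exists_of_iso [(𝔼.H 𝓣).Full] {R₁ R₂ : 𝔼.SyzygyCat 𝓣} (f : R₁ ⟶ R₂)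
    (e : (𝔼.H 𝓣).obj X ≅ cokernel (preadditiveYoneda.map f)) :
    ∃ u : R₂.obj ⟶ X, IsPresentation 𝓣 f.hom u := by
  obtain ⟨u, hu⟩ := (𝔼.H 𝓣).map_surjective
    ((yonedaIsoH R₂).inv ≫ cokernel.π (preadditiveYoneda.map f) ≫ e.inv)
  have hS := ShortComplex.exact_cokernel (preadditiveYoneda.map f)
  have hepi : Epi ((𝔼.H 𝓣).map u) := by rw [hu]; infer_instance
  rw [NatTrans.epi_iff_epi_app] at hepi
  refine ⟨u, fun R hR z => ?_, ?_, fun R hR a ha => ?_⟩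
  · exact (AddCommGrpCat.epi_iff_surjective _).1 (hepi (op ⟨R, hR⟩)) z
  · have : (𝔼.H 𝓣).map (f.hom ≫ u) = 0 := by
      rw [Functor.map_comp, hu, ← Category.assoc, ← Category.assoc]
      have : (𝔼.H 𝓣).map f.hom ≫ (yonedaIsoH R₂).inv =
          (yonedaIsoH R₁).inv ≫ preadditiveYoneda.map f := rfl
      rw [this]
      simp
    simpa using (H_map_eq_zero_iff _).1 this _ R₁.property (𝟙 _)
  · have h₁ := (ShortComplex.ab_exact_iff _).1 (hS.map ((evaluation _ _).obj (op ⟨R, hR⟩)))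
    have h₂ : cokernel.π (preadditiveYoneda.map f) =
        (yonedaIsoH R₂).hom ≫ (𝔼.H 𝓣).map u ≫ e.hom := by
      rw [hu]; simp
    let a' : (⟨R, hR⟩ : 𝔼.SyzygyCat 𝓣) ⟶ R₂ := ObjectProperty.homMk a
    obtain ⟨b, hb⟩ := h₁ a' (by
      change (cokernel.π (preadditiveYoneda.map f)).app (op ⟨R, hR⟩) a' = 0
      rw [h₂]
      change e.hom.app (op ⟨R, hR⟩) (a ≫ u) = 0
      rw [ha]
      exact map_zero (e.hom.app (op ⟨R, hR⟩)).hom)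
    let b' : (⟨R, hR⟩ : 𝔼.SyzygyCat 𝓣) ⟶ R₁ := b
    have hb' : b' ≫ f = a' := hb
    exact ⟨b'.hom, congr_arg InducedCategory.Hom.hom hb'⟩

end IsPresentation

/-- Stable exactness of an `E`-triangle at its middle term. -/
lemma Tri.exists_stable_lift {A X C W : B} {x : A ⟶ X} {y : X ⟶ C} {δ : Ext 𝔼.E C A}
    (h : 𝔼.Tri x y δ) (a : W ⟶ X) (ha : 𝔼.toStable.map (a ≫ y) = 0) :
    ∃ b : W ⟶ A, 𝔼.toStable.map (b ≫ x) = 𝔼.toStable.map a := by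
  obtain ⟨b, hb, hb'⟩ := h.exists_lift_of_factorsProj (toStable_map_eq_zero_iff.1 ha)
  obtain ⟨c, hc⟩ := h.exists_lift (a - b) (by rw [Preadditive.sub_comp, hb, sub_self])
  refine ⟨c, ?_⟩
  rw [hc, Functor.map_sub, toStable_map_eq_zero_iff.2 hb', sub_zero]

/-- Approximate X, then approximate the kernel term K of the resulting triangle. -/
lemma exists_isPresentation (hProj : 𝔼.EnoughProjectives) (hInj : 𝔼.EnoughInjectives)
    (hFin : ContravariantlyFinite 𝓣) (X : B) :
    ∃ (R₁ R₂ : B) (f : R₁ ⟶ R₂) (u : R₂ ⟶ X), 𝔼.syzygy 𝓣 R₁ ∧ 𝔼.syzygy 𝓣 R₂ ∧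
      IsPresentation 𝓣 (𝔼.toStable.map f) (𝔼.toStable.map u) := by
  obtain ⟨K, R₂, d, e, ε, h, hR₂, happ⟩ := exists_approximation hProj hInj hFin X
  obtain ⟨-, R₁, -, e', -, -, hR₁, happ'⟩ := exists_approximation hProj hInj hFin K
  refine ⟨R₁, R₂, e' ≫ d, e, hR₁, hR₂, fun R hR z => ?_, ?_, fun R hR a ha => ?_⟩
  · obtain ⟨z, rfl⟩ := exists_toStable_map (X := R.as) z
    obtain ⟨b, hb⟩ := happ _ z hR
    exact ⟨𝔼.toStable.map b, by rw [← hb, Functor.map_comp]⟩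
  · rw [← Functor.map_comp, Category.assoc, h.comp_eq_zero, comp_zero, Functor.map_zero]
  · obtain ⟨a, rfl⟩ := exists_toStable_map (X := R.as) a
    obtain ⟨b, hb⟩ := h.exists_stable_lift a (by rw [Functor.map_comp]; exact ha)
    obtain ⟨c, hc⟩ := happ' _ b hR
    refine ⟨𝔼.toStable.map c, ?_⟩
    rw [← hb, Functor.map_comp, Functor.map_comp, ← hc, Functor.map_comp]
    simp only [Category.assoc]

/-! ### Presentations coming from diagrams. -/

namespace Diagram

variable {A : B} (D : 𝔼.Diagram 𝓣 A)

lemma H_map_h_eq_zero_iff : (𝔼.H 𝓣).map (𝔼.toStable.map D.h) = 0 ↔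
    ∀ R : 𝔼.Stable, 𝔼.stableSyzygy 𝓣 R → ∀ z : R ⟶ 𝔼.toStable.obj A,
      ∃ a : R ⟶ 𝔼.toStable.obj D.R₂, a ≫ 𝔼.toStable.map D.g = z := by
  rw [H_map_eq_zero_iff]
  refine forall₃_congr fun R hR z => ⟨fun h => ?_, ?_⟩
  · obtain ⟨z, rfl⟩ := exists_toStable_map (X := R.as) z
    rw [← Functor.map_comp, toStable_map_eq_zero_iff] at h
    -- If z ≫ h is stably zero it lifts through p. As the left column is the pullback of the right
    -- one along h, z then kills its class and lifts through g.
    obtain ⟨b, hb, -⟩ := D.tri_colRight.exists_lift_of_factorsProj h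
    obtain ⟨a, ha⟩ := D.tri_colLeft.exists_coextend z (by
      rw [← D.pull_colRight, ← pull_comp, ← hb, pull_comp, D.tri_colRight.pull_eq_zero,
        pull_zero])
    exact ⟨𝔼.toStable.map a, by rw [← ha, Functor.map_comp]⟩
  · rintro ⟨a, rfl⟩
    rw [Category.assoc, ← Functor.map_comp, D.comm_left,
      toStable_map_eq_zero_iff.2 ⟨D.P, D.r, D.p, D.proj_P, rfl⟩, comp_zero]

lemma isPresentation (h : (𝔼.H 𝓣).map (𝔼.toStable.map D.h) = 0) :
    IsPresentation 𝓣 (𝔼.toStable.map D.f) (𝔼.toStable.map D.g) where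
  surj := D.H_map_h_eq_zero_iff.1 h
  zero := by rw [← Functor.map_comp, D.tri_colLeft.comp_eq_zero, Functor.map_zero]
  exact R _ a ha := by
    obtain ⟨a, rfl⟩ := exists_toStable_map (X := R.as) a
    obtain ⟨b, hb⟩ := D.tri_colLeft.exists_stable_lift a (by rw [Functor.map_comp]; exact ha)
    exact ⟨𝔼.toStable.map b, by rw [← hb, Functor.map_comp]⟩

/-- By Yoneda, α is determined by its value on g, a map R₂ → Y that kills f; the weak cokernel
property factors it through g. -/
lemma exists_H_map_eq
    (hTP : ∀ T P : B, 𝓣 T → 𝔼.proj P → ∀ δ : Ext 𝔼.E T P, δ = 0)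
    (h : (𝔼.H 𝓣).map (𝔼.toStable.map D.h) = 0) {Y : 𝔼.Stable}
    (α : (𝔼.H 𝓣).obj (𝔼.toStable.obj A) ⟶ (𝔼.H 𝓣).obj Y) :
    ∃ c : 𝔼.toStable.obj A ⟶ Y, (𝔼.H 𝓣).map c = α := by
  have hR₁ : 𝔼.stableSyzygy 𝓣 (𝔼.toStable.obj D.R₁) := D.syzygy_R₁
  have hR₂ : 𝔼.stableSyzygy 𝓣 (𝔼.toStable.obj D.R₂) := D.syzygy_R₂
  have hD := D.isPresentation h
  obtain ⟨b, hb⟩ := exists_toStable_map (Y := Y.as) (evalH α hR₂ (𝔼.toStable.map D.g))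
  obtain ⟨c, hc⟩ := D.exists_stable_desc hTP b (by
    rw [Functor.map_comp, hb, ← comp_evalH α hR₁, hD.zero, evalH_zero])
  refine ⟨𝔼.toStable.map c, H_hom_ext fun R hR z => ?_⟩
  obtain ⟨a, rfl⟩ := hD.surj R hR z
  rw [evalH_map, Category.assoc, ← Functor.map_comp, hc, hb, ← comp_evalH α hR]

/-- Comparison of the object `A` of a diagram with an object `X` such that `H X` is the cokernel
of the right minimal morphism `f`, in case `H` is full. -/
lemma exists_comparison [(𝔼.H 𝓣).Full]
    (hTP : ∀ T P : B, 𝓣 T → 𝔼.proj P → ∀ δ : Ext 𝔼.E T P, δ = 0)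
    (hmin : RightMinimal (𝔼.toStable.map D.f)) {X : 𝔼.Stable}
    {u : 𝔼.toStable.obj D.R₂ ⟶ X} (hu : IsPresentation 𝓣 (𝔼.toStable.map D.f) u) :
    ∃ (c : 𝔼.toStable.obj A ⟶ X) (s : X ⟶ 𝔼.toStable.obj A), u ≫ s ≫ c = u ∧
      IsIso (c ≫ s) ∧ (𝔼.H 𝓣).map (𝔼.toStable.map D.h) = 0 := by
  obtain ⟨u, rfl⟩ := exists_toStable_map (Y := X.as) u
  obtain ⟨c, hc⟩ := D.exists_stable_desc hTP u (by rw [Functor.map_comp]; exact hu.zero)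
  obtain ⟨s, hs⟩ := hu.exists_desc D.syzygy_R₂ (𝔼.toStable.map D.g)
    (by rw [← Functor.map_comp, D.tri_colLeft.comp_eq_zero, Functor.map_zero])
  obtain ⟨s, rfl⟩ := exists_toStable_map (X := X.as) s
  rw [Functor.map_comp] at hc
  have hiso : IsIso (𝔼.toStable.map c ≫ 𝔼.toStable.map s) := by
    rw [← Functor.map_comp]
    refine D.isIso_stable_of_rightMinimal hTP hmin _ ?_
    rw [Functor.map_comp, Functor.map_comp, reassoc_of% hc]
    exact hs
  refine ⟨𝔼.toStable.map c, 𝔼.toStable.map s, ?_, hiso, ?_⟩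
  · rw [← Category.assoc]
    exact (congr_arg (· ≫ 𝔼.toStable.map c) hs).trans hc
  · rw [H_map_h_eq_zero_iff]
    intro R hR z
    -- Twisting z by the inverse of c ≫ s makes its image under s equal to z again.
    obtain ⟨a, ha⟩ := hu.surj R hR (z ≫ inv (𝔼.toStable.map c ≫ 𝔼.toStable.map s) ≫
      𝔼.toStable.map c)
    refine ⟨a, ?_⟩
    rw [← hs, ← Category.assoc, ha]
    simp

end Diagram

lemma rightMinimal_of_iso {C : Type u} [Category.{v} C] {X Y X' Y' : C} {f : X ⟶ Y}
    {f' : X' ⟶ Y'} (hf : RightMinimal f) (e₁ : X' ≅ X) (e₂ : Y' ≅ Y)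
    (h : f' ≫ e₂.hom = e₁.hom ≫ f) : RightMinimal f' := by
  intro r hr
  have := hf (e₁.inv ≫ r ≫ e₁.hom) (by
    rw [Category.assoc, Category.assoc, ← h, reassoc_of% hr, h, e₁.inv_hom_id_assoc])
  have h' : r = e₁.hom ≫ (e₁.inv ≫ r ≫ e₁.hom) ≫ e₁.inv := by simp
  rw [h']
  infer_instance

/-- Every morphism of `Ω 𝓣` is, up to a summand of its source on which it vanishes stably, the
right minimal morphism `f` of a diagram. -/
lemma exists_rightMinimal_diagram (k : Type*) [Field k] [Linear k B]
    (hf : ∀ X Y : B, Module.Finite k (X ⟶ Y)) (hKS : KrullSchmidt B)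
    [𝓣.IsClosedUnderIsomorphisms] (hSum : ∀ X Y : B, 𝓣 X → 𝓣 Y → 𝓣 (X ⊞ Y))
    (hSummand : ∀ X Y : B, 𝓣 (X ⊞ Y) → 𝓣 X) (hP : 𝔼.proj ≤ 𝓣)
    (hTP : ∀ T P : B, 𝓣 T → 𝔼.proj P → ∀ δ : Ext 𝔼.E T P, δ = 0) {R₁ R₂ : B}
    (hR₁ : 𝔼.syzygy 𝓣 R₁) (hR₂ : 𝔼.syzygy 𝓣 R₂) (f : R₁ ⟶ R₂) :
    ∃ (A : B) (D : 𝔼.Diagram 𝓣 A) (a : 𝔼.toStable.obj D.R₁ ⟶ 𝔼.toStable.obj R₁)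
      (b : 𝔼.toStable.obj R₁ ⟶ 𝔼.toStable.obj D.R₁)
      (e : 𝔼.toStable.obj D.R₂ ≅ 𝔼.toStable.obj R₂),
      RightMinimal (𝔼.toStable.map D.f) ∧
      a ≫ 𝔼.toStable.map f = 𝔼.toStable.map D.f ≫ e.hom ∧
      b ≫ 𝔼.toStable.map D.f ≫ e.hom = 𝔼.toStable.map f := by
  obtain ⟨W, i, p, hip, hmin, hpif⟩ := exists_rightMinimal (𝔼 := 𝔼) k hf hKS _ R₁ f rfl
  obtain ⟨A, D, e₁, e₂, he⟩ := exists_diagram hSum hP hTP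
    (syzygy_of_retract k hf hKS hSummand hTP hR₁ i p hip) hR₂ (i ≫ f)
  refine ⟨A, D, e₁.hom ≫ 𝔼.toStable.map i, 𝔼.toStable.map p ≫ e₁.inv, e₂,
    rightMinimal_of_iso hmin e₁ e₂ he, ?_, ?_⟩
  · rw [he, Category.assoc, ← Functor.map_comp]
  · rw [he, Category.assoc, e₁.inv_hom_id_assoc, ← Functor.map_comp, hpif]

end ExtriangulatedStructure

/-! ### The two implications of the equivalence. -/

namespace ExtriangulatedStructure

variable {B : Type u} [Category.{v} B] [Preadditive B] [HasZeroObject B] [HasBinaryBiproducts B]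
  {𝔼 : ExtriangulatedStructure.{w} B} {𝓣 : ObjectProperty B}

lemma finitelyPresented_H_obj (hProj : 𝔼.EnoughProjectives) (hInj : 𝔼.EnoughInjectives)
    (hFin : ContravariantlyFinite 𝓣) (X : 𝔼.Stable) : FinitelyPresented ((𝔼.H 𝓣).obj X) := by
  obtain ⟨R₁, R₂, f, u, hR₁, hR₂, h⟩ := exists_isPresentation hProj hInj hFin X.as
  let f' : (⟨𝔼.toStable.obj R₁, hR₁⟩ : 𝔼.SyzygyCat 𝓣) ⟶ ⟨𝔼.toStable.obj R₂, hR₂⟩ :=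
    ObjectProperty.homMk (𝔼.toStable.map f)
  exact ⟨_, _, f', IsPresentation.nonempty_iso (X := X) (f := f') h⟩

/-- Lift α on each summand of X with local endomorphism ring, either by 0 or through a diagram, and
add up the lifts. -/
lemma full_H (hKS : KrullSchmidt B)
    (hTP : ∀ T P : B, 𝓣 T → 𝔼.proj P → ∀ δ : Ext 𝔼.E T P, δ = 0)
    (hD : ∀ A : B, Indecomposable A → ¬ IsZero ((𝔼.H 𝓣).obj (𝔼.toStable.obj A)) →
      ∃ D : 𝔼.Diagram 𝓣 A, (𝔼.H 𝓣).map (𝔼.toStable.map D.h) = 0) : (𝔼.H 𝓣).Full where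
  map_surjective {X Y} α := by
    obtain ⟨n, A, p, q, hA, hs⟩ := hKS.exists_sum_eq_id X.as
    have hloc : ∀ i, ∃ c : 𝔼.toStable.obj (A i) ⟶ Y,
        (𝔼.H 𝓣).map c = (𝔼.H 𝓣).map (𝔼.toStable.map (q i)) ≫ α := by
      intro i
      by_cases h0 : IsZero ((𝔼.H 𝓣).obj (𝔼.toStable.obj (A i)))
      · exact ⟨0, h0.eq_of_src _ _⟩
      · obtain ⟨D, h⟩ := hD _ (indecomposable_of_isLocalRing (hA i)) h0
        exact D.exists_H_map_eq hTP h _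
    choose c hc using hloc
    refine ⟨∑ i, 𝔼.toStable.map (p i) ≫ c i, H_hom_ext fun R hR z => ?_⟩
    have hz : z = ∑ i, (z ≫ 𝔼.toStable.map (p i)) ≫ 𝔼.toStable.map (q i) := by
      simp only [Category.assoc, ← Functor.map_comp]
      rw [← Preadditive.comp_sum, ← Functor.map_sum, hs]
      exact ((congr_arg (z ≫ ·) (𝔼.toStable.map_id X.as)).trans (Category.comp_id z)).symm
    rw [evalH_map, Preadditive.comp_sum]
    conv_rhs => rw [hz]
    refine Eq.trans ?_ (evalH_sum α hR _).symm
    refine Finset.sum_congr rfl fun i _ => ?_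
    have := congr_arg (fun β => evalH β hR (z ≫ 𝔼.toStable.map (p i))) (hc i)
    rw [← Category.assoc]
    exact this

lemma dense_H (k : Type*) [Field k] [Linear k B]
    (hf : ∀ X Y : B, Module.Finite k (X ⟶ Y)) (hKS : KrullSchmidt B)
    [𝓣.IsClosedUnderIsomorphisms] (hSum : ∀ X Y : B, 𝓣 X → 𝓣 Y → 𝓣 (X ⊞ Y))
    (hSummand : ∀ X Y : B, 𝓣 (X ⊞ Y) → 𝓣 X) (hP : 𝔼.proj ≤ 𝓣)
    (hTP : ∀ T P : B, 𝓣 T → 𝔼.proj P → ∀ δ : Ext 𝔼.E T P, δ = 0)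
    (hD : ∀ (A : B) (D : 𝔼.Diagram 𝓣 A), 𝔼.toStable.map D.f ≠ 0 →
      RightMinimal (𝔼.toStable.map D.f) → (𝔼.H 𝓣).map (𝔼.toStable.map D.h) = 0)
    (F : (𝔼.SyzygyCat 𝓣)ᵒᵖ ⥤ AddCommGrpCat.{v}) (hF : FinitelyPresented F) :
    ∃ X : 𝔼.Stable, Nonempty ((𝔼.H 𝓣).obj X ≅ F) := by
  obtain ⟨R₁, R₂, f, ⟨ε⟩⟩ := hF
  suffices h : ∃ (X : 𝔼.Stable) (u : R₂.obj ⟶ X), IsPresentation 𝓣 f.hom u by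
    obtain ⟨X, u, hu⟩ := h
    obtain ⟨ε'⟩ := hu.nonempty_iso
    exact ⟨X, ⟨ε' ≪≫ ε.symm⟩⟩
  obtain ⟨f', hf'⟩ := exists_toStable_map (X := R₁.obj.as) (Y := R₂.obj.as) f.hom
  obtain ⟨A, D, a, b, e, hmin, ha, hb⟩ := exists_rightMinimal_diagram k hf hKS hSum hSummand hP hTP
    R₁.property R₂.property f'
  rw [hf'] at ha hb
  -- Condition (a) is silent about a zero f; then R₂ itself represents the cokernel.
  by_cases h0 : 𝔼.toStable.map D.f = 0
  · have hf0 : f.hom = 0 := by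
      rw [h0, zero_comp, comp_zero] at hb
      exact hb.symm
    refine ⟨R₂.obj, 𝟙 _, fun R _ z => ⟨z, Category.comp_id z⟩, by rw [hf0, zero_comp],
      fun R _ z hz => ⟨0, ?_⟩⟩
    rw [Category.comp_id] at hz
    rw [zero_comp, hz]
  · exact ⟨_, _, (D.isPresentation (hD A D h0 hmin)).transport e b hb a ha⟩

lemma H_map_h_eq_zero_of_full_of_dense
    (hTP : ∀ T P : B, 𝓣 T → 𝔼.proj P → ∀ δ : Ext 𝔼.E T P, δ = 0) [(𝔼.H 𝓣).Full]
    (hdense : ∀ F : (𝔼.SyzygyCat 𝓣)ᵒᵖ ⥤ AddCommGrpCat.{v}, FinitelyPresented F →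
      ∃ X : 𝔼.Stable, Nonempty ((𝔼.H 𝓣).obj X ≅ F)) {A : B} (D : 𝔼.Diagram 𝓣 A)
    (hmin : RightMinimal (𝔼.toStable.map D.f)) :
    (𝔼.H 𝓣).map (𝔼.toStable.map D.h) = 0 := by
  let f : (⟨𝔼.toStable.obj D.R₁, D.syzygy_R₁⟩ : 𝔼.SyzygyCat 𝓣) ⟶
    ⟨𝔼.toStable.obj D.R₂, D.syzygy_R₂⟩ := ObjectProperty.homMk (𝔼.toStable.map D.f)
  obtain ⟨X, ⟨e⟩⟩ := hdense _ ⟨_, _, f, ⟨Iso.refl _⟩⟩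
  obtain ⟨u, hu⟩ := IsPresentation.exists_of_iso f e
  obtain ⟨-, -, -, -, h⟩ := D.exists_comparison hTP hmin hu
  exact h

/-- A stably trivial direct summand of the object of a diagram can be split off. -/
lemma Diagram.exists_of_iso_biprod [𝓣.IsClosedUnderIsomorphisms]
    (hSum : ∀ X Y : B, 𝓣 X → 𝓣 Y → 𝓣 (X ⊞ Y)) (hP : 𝔼.proj ≤ 𝓣)
    (hTP : ∀ T P : B, 𝓣 T → 𝔼.proj P → ∀ δ : Ext 𝔼.E T P, δ = 0)
    (hProj : 𝔼.EnoughProjectives) {A' A Q : B} (D : 𝔼.Diagram 𝓣 A') (e : A' ≅ A ⊞ Q)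
    (hQ : 𝔼.proj Q) :
    ∃ (D' : 𝔼.Diagram 𝓣 A) (j : D.T₁ ⟶ D'.T₁), D'.h = biprod.inl ≫ e.inv ≫ D.h ≫ j := by
  have h : 𝔼.Tri (biprod.inl ≫ e.inv) (e.hom ≫ biprod.snd) (0 : Ext 𝔼.E Q A) :=
    𝔼.tri_of_equiv e.symm (𝔼.tri_zero A Q) rfl (by simp)
  -- The cone of A → A' → T₁ is an extension of T₂ by Q; it splits because E(T₂, Q) = 0, so it lies
  -- in 𝓣.
  obtain ⟨G, h', d, t, δ'', -, -, hG, hQG, -⟩ := 𝔼.et4 h D.tri_rowBot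
  obtain ⟨i⟩ := hQG.nonempty_iso_biprod (hTP _ _ D.mem_T₂ hQ _)
  obtain ⟨D', j, hj⟩ := exists_diagram_of_tri hProj hG D.mem_T₁
    (𝓣.prop_of_iso i.symm (hSum _ _ (hP _ hQ) D.mem_T₂))
  exact ⟨D', j, by simpa using hj⟩

lemma exists_diagram_of_full (k : Type*) [Field k] [Linear k B]
    (hf : ∀ X Y : B, Module.Finite k (X ⟶ Y)) (hKS : KrullSchmidt B)
    [𝓣.IsClosedUnderIsomorphisms] (hSum : ∀ X Y : B, 𝓣 X → 𝓣 Y → 𝓣 (X ⊞ Y))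
    (hSummand : ∀ X Y : B, 𝓣 (X ⊞ Y) → 𝓣 X) (hP : 𝔼.proj ≤ 𝓣)
    (hTP : ∀ T P : B, 𝓣 T → 𝔼.proj P → ∀ δ : Ext 𝔼.E T P, δ = 0)
    (hProj : 𝔼.EnoughProjectives) (hInj : 𝔼.EnoughInjectives)
    (hFin : ContravariantlyFinite 𝓣) [(𝔼.H 𝓣).Full] {A : B} (hA : Indecomposable A)
    (hHA : ¬ IsZero ((𝔼.H 𝓣).obj (𝔼.toStable.obj A))) :
    ∃ D : 𝔼.Diagram 𝓣 A, (𝔼.H 𝓣).map (𝔼.toStable.map D.h) = 0 := by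
  obtain ⟨R₁, R₂, f, u, hR₁, hR₂, hu⟩ := exists_isPresentation hProj hInj hFin A
  obtain ⟨A', D, a, b, e, hmin, ha, hb⟩ := exists_rightMinimal_diagram k hf hKS hSum hSummand hP
    hTP hR₁ hR₂ f
  have hu' := hu.transport (f' := 𝔼.toStable.map D.f) e.symm a
    (by rw [← Category.assoc, ha]; simp) b (by rw [← hb]; simp)
  obtain ⟨c, s, hsc, hcs, hh⟩ := D.exists_comparison hTP hmin hu'
  obtain ⟨c, rfl⟩ := exists_toStable_map c
  obtain ⟨s, rfl⟩ := exists_toStable_map s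
  have hz : ∀ R : 𝔼.Stable, 𝔼.stableSyzygy 𝓣 R → ∀ z : R ⟶ 𝔼.toStable.obj A,
      z ≫ 𝔼.toStable.map (s ≫ c) = z := by
    intro R hR z
    obtain ⟨z, rfl⟩ := hu'.surj R hR z
    rw [Functor.map_comp, Category.assoc, hsc]
  -- Since s ≫ c acts as the identity on H(A), invertibility of 1 - s ≫ c would force H(A) = 0.
  have hiso : IsIso (s ≫ c) := by
    refine (isIso_or_isIso_one_sub_of_indecomposable k hf hKS hA _).resolve_right fun h => hHA ?_
    refine isZero_H_obj fun R hR z => ?_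
    have h0 : z ≫ 𝔼.toStable.map (𝟙 A - s ≫ c) = 0 := by
      rw [Functor.map_sub, Preadditive.comp_sub, hz R hR, 𝔼.toStable.map_id, Category.comp_id,
        sub_self]
    rw [← cancel_mono (𝔼.toStable.map (𝟙 A - s ≫ c)), h0, zero_comp]
  have hs : IsIso (𝔼.toStable.map s) :=
    isIso_of_isIso_comp _ (𝔼.toStable.map c) (by rw [← Functor.map_comp]; infer_instance) hcs
  obtain ⟨Q, i, -, hi⟩ := hKS.exists_iso_biprod s (c ≫ inv (s ≫ c))
    (by rw [← Category.assoc, IsIso.hom_inv_id])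
  -- A is a summand of A' in B via s, which is a stable isomorphism; so the complement Q vanishes
  -- stably.
  have hQ : 𝔼.proj Q := by
    refine proj_of_id_factorsProj (toStable_map_eq_zero_iff.1 ?_)
    have h0 : 𝔼.toStable.map (i.hom ≫ biprod.snd) = 0 := by
      rw [← cancel_epi (𝔼.toStable.map s), ← Functor.map_comp, ← hi]
      simp
    have h1 : 𝟙 Q = (biprod.inr ≫ i.inv) ≫ i.hom ≫ biprod.snd := by simp
    rw [h1, Functor.map_comp, h0, comp_zero]
  obtain ⟨D', j, hj⟩ := D.exists_of_iso_biprod hSum hP hTP hProj i hQ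
  refine ⟨D', ?_⟩
  rw [hj, reassoc_of% hi]
  simp only [Functor.map_comp]
  rw [hh]
  simp

end ExtriangulatedStructure

end Extri

end

theorem theorem1p2 {k : Type*} [Field k] {B : Type u} [Category.{v} B] [Preadditive B]
    [HasZeroObject B] [HasBinaryBiproducts B] [Linear k B]
    (hHomFinite : ∀ X Y : B, Module.Finite k (X ⟶ Y))
    (hKS : Extri.KrullSchmidt B)
    (𝔼 : Extri.ExtriangulatedStructure.{w} B)
    (hProj : 𝔼.EnoughProjectives) (hInj : 𝔼.EnoughInjectives)
    (𝓣 : ObjectProperty B) [𝓣.IsClosedUnderIsomorphisms]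
    (hSum : ∀ X Y : B, 𝓣 X → 𝓣 Y → 𝓣 (X ⊞ Y))
    (hSummand : ∀ X Y : B, 𝓣 (X ⊞ Y) → 𝓣 X)
    (hFin : Extri.ContravariantlyFinite 𝓣)
    (hP : 𝔼.proj ≤ 𝓣)
    (hTP : ∀ T P : B, 𝓣 T → 𝔼.proj P → ∀ δ : Extri.Ext 𝔼.E T P, δ = 0) :
    (∀ X : 𝔼.Stable, Extri.FinitelyPresented ((𝔼.H 𝓣).obj X)) ∧
    (((𝔼.H 𝓣).Full ∧
        ∀ F : (𝔼.SyzygyCat 𝓣)ᵒᵖ ⥤ AddCommGrpCat.{v}, Extri.FinitelyPresented F →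
          ∃ X : 𝔼.Stable, Nonempty ((𝔼.H 𝓣).obj X ≅ F)) ↔
      ((∀ (A : B) (D : 𝔼.Diagram 𝓣 A), 𝔼.toStable.map D.f ≠ 0 →
          Extri.RightMinimal (𝔼.toStable.map D.f) →
          (𝔼.H 𝓣).map (𝔼.toStable.map D.h) = 0) ∧
        (∀ A : B, Indecomposable A → ¬ IsZero ((𝔼.H 𝓣).obj (𝔼.toStable.obj A)) →
          ∃ D : 𝔼.Diagram 𝓣 A, (𝔼.H 𝓣).map (𝔼.toStable.map D.h) = 0))) := by
  refine ⟨fun X => Extri.ExtriangulatedStructure.finitelyPresented_H_obj hProj hInj hFin X,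
    ⟨?_, ?_⟩⟩
  · rintro ⟨hfull, hdense⟩
    exact ⟨fun A D _ hmin =>
        Extri.ExtriangulatedStructure.H_map_h_eq_zero_of_full_of_dense hTP hdense D hmin,
      fun A hA hHA => Extri.ExtriangulatedStructure.exists_diagram_of_full k hHomFinite hKS hSum
        hSummand hP hTP hProj hInj hFin hA hHA⟩
  · rintro ⟨ha, hb⟩
    exact ⟨Extri.ExtriangulatedStructure.full_H hKS hTP hb,
      fun F hF => Extri.ExtriangulatedStructure.dense_H k hHomFinite hKS hSum hSummand hP hTP ha
        F hF⟩
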